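/- Let $X=\{X_{t_1,t_2}:t_1,t_2\ge 0\}$ be a two-parameter Lévy process on $\mathbb{R}^d$, i.e. its increments over disjoint rectangles $(s,t]=(s_1,t_1]\times(s_2,t_2]$ are independent, the law of the increment over a rectangle is invariant under translations of the rectangle, $X$ vanishes on the axes a.s., is continuous in probability, and its sample paths are a.s. right continuous with quadrantal limits. Let $\psi$ be its characteristic exponent, i.e. the continuous function with $\psi(0)=0$ and $\mathrm{E}[e^{i\langle z,X_{1,1}\rangle}]=e^{\psi(z)}$, $z\in\mathbb{R}^d$. Assume that $X$ is nondeterministic ($X_{t_1,t_2}$ is not a.s. constant for $t_1,t_2>0$), and call $X$ symmetric if $X$ and $-X$ are identical in law. Let $T\subseteq\mathbb{R}$ be an interval with interior $T^\circ$, and let $\alpha(t)=(x(t),y(t))$, $t\in T$, be a decreasing path in $[0,\infty)^2$: $x$ is nondecreasing, $y$ is nonincreasing, both are continuous on $T$ and strictly positive on $T^\circ$, and at least one of them is not constant. Put $X^\alpha_t=X_{x(t),y(t)}$, $t\in T$. We say that $X^\alpha$ has stationary increments if the law of $X^\alpha_t-X^\alpha_s$, for $s<t$ in $T$, depends only on $t-s$.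 Consider the following conditions on $\alpha$, each with an associated function $\varphi$ of $u\in\{t-s:s,t\in T,\,s<t\}$: (i) $x(t)=a$, $y(t)=b-ct$ for $t\in T$, or $x(t)=b+ct$, $y(t)=a$ for $t\in T$, for some $b\in\mathbb{R}$ and $a,c>0$; $\varphi(u)=acu$. (ii) $x(t)=a+d(t-s^*)\mathbf{1}_{\{t>s^*\}}$, $y(t)=b-c(t-s^*)\mathbf{1}_{\{t\le s^*\}}$ for $t\in T$, for some $s^*\in T^\circ$ and $a,b,c,d>0$ with $ac=bd$; $\varphi(u)=acu$. (iii) $x(t)=a+bt$, $y(t)=c-dt$ for $t\in T$, for some $a,c\in\mathbb{R}$ and $b,d>0$; $\varphi(u)=(ad+bc)u-bdu^2$. (iv) $x(t)=ae^{ct}$, $y(t)=be^{-ct}$ for $t\in T$, for some $a,b,c>0$; $\varphi(u)=2ab(1-e^{-cu})$. If $X$ is symmetric, then $X^\alpha$ has stationary increments if and only if $\alpha$ meets one of the conditions (i)–(iv), and under any of these conditions, with the corresponding $\varphi$, $$\mathrm{E}\big[e^{i\langle z,X^\alpha_t-X^\alpha_s\rangle}\big]=\exp\big[\varphi(t-s)\,\psi(z)\big],\qquad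 z\in\mathbb{R}^d,\ s,t\in T,\ s<t.$$ If $X$ is not symmetric, then $X^\alpha$ has stationary increments if and only if $\alpha$ meets one of the conditions (i) and (iv), and under condition (iv), with the corresponding $\varphi$, $$\mathrm{E}\big[e^{i\langle z,X^\alpha_t-X^\alpha_s\rangle}\big]=\exp\Big[\varphi(t-s)\,\frac{\psi(z)+\psi(-z)}{2}\Big],\qquad z\in\mathbb{R}^d,\ s,t\in T,\ s<t.$$ -/

import Mathlib

open MeasureTheory ProbabilityTheory Filter Topology
open scoped NNReal

namespace LevySheet

/-- The parameter set `[0,∞)²` (with the product order). -/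
abbrev Quarter : Type := ℝ≥0 × ℝ≥0

/-- The rectangle `(s,t] = (s₁,t₁] × (s₂,t₂]`. -/
def rect (s t : Quarter) : Set Quarter := Set.Ioc s.1 t.1 ×ˢ Set.Ioc s.2 t.2

/-- The quadrants at `t`. -/
def Q₁ (t : Quarter) : Set Quarter := {s | t.1 ≤ s.1 ∧ t.2 ≤ s.2}
def Q₂ (t : Quarter) : Set Quarter := {s | s.1 < t.1 ∧ t.2 ≤ s.2}
def Q₃ (t : Quarter) : Set Quarter := {s | s.1 < t.1 ∧ s.2 < t.2}
def Q₄ (t : Quarter) : Set Quarter := {s | t.1 ≤ s.1 ∧ s.2 < t.2}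

/-- Quadrantal limits: the limit from each of the four quadrants at each point exists (no condition
when the quadrant is empty, since then `𝓝[∅] t = ⊥`). -/
def HasQuadrantalLimits {E : Type*} [TopologicalSpace E] (f : Quarter → E) : Prop :=
  ∀ t : Quarter,
    (∃ l, Tendsto f (𝓝[Q₁ t] t) (𝓝 l)) ∧ (∃ l, Tendsto f (𝓝[Q₂ t] t) (𝓝 l)) ∧
    (∃ l, Tendsto f (𝓝[Q₃ t] t) (𝓝 l)) ∧ (∃ l, Tendsto f (𝓝[Q₄ t] t) (𝓝 l))

/-- Right continuity: `f t` is the limit of `f` at `t` from the quadrant `Q₁ t`. -/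
def IsRightContinuous {E : Type*} [TopologicalSpace E] (f : Quarter → E) : Prop :=
  ∀ t : Quarter, Tendsto f (𝓝[Q₁ t] t) (𝓝 (f t))

section Sheets

variable {Ω : Type*} [MeasurableSpace Ω] {d : ℕ}

/-- The increment `X((s,t])` of a two-parameter process over the rectangle `(s,t]`. -/
def increment (X : Quarter → Ω → EuclideanSpace ℝ (Fin d)) (s t : Quarter) (ω : Ω) :
    EuclideanSpace ℝ (Fin d) :=
  X t ω - X (s.1, t.2) ω - X (t.1, s.2) ω + X s ω

/-- Two-parameter Lévy processes on `ℝ^d`. -/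
structure IsTPLP (P : Measure Ω) (X : Quarter → Ω → EuclideanSpace ℝ (Fin d)) : Prop where
  /-- each `X t` is a random vector -/
  measurable : ∀ t, Measurable (X t)
  /-- increments over disjoint rectangles are independent -/
  indep : ∀ (n : ℕ) (s t : Fin n → Quarter), (∀ i, s i ≤ t i) →
    Pairwise (fun i j => Disjoint (rect (s i) (t i)) (rect (s j) (t j))) →
    iIndepFun (fun i => increment X (s i) (t i)) P
  /-- increments over translated rectangles are identically distributed -/
  stationary : ∀ s t p : Quarter, s ≤ t →
    IdentDistrib (increment X s t) (increment X (s + p) (t + p)) P P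
  /-- `X` vanishes on the axes almost surely -/
  axes : ∀ᵐ ω ∂P, ∀ u : ℝ≥0, X (u, 0) ω = 0 ∧ X (0, u) ω = 0
  /-- `X` is continuous in probability -/
  continuous_prob : ∀ t, TendstoInMeasure P X (𝓝 t) (X t)
  /-- almost all sample paths are right continuous with quadrantal limits -/
  paths : ∀ᵐ ω ∂P, IsRightContinuous (fun t => X t ω) ∧ HasQuadrantalLimits (fun t => X t ω)

/-- `ψ` is the characteristic exponent of `X`: the continuous logarithm, vanishing at `0`, of the
characteristic function of `X_{1,1}`. -/
structure IsExponent (P : Measure Ω) (X : Quarter → Ω → EuclideanSpace ℝ (Fin d))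
    (ψ : EuclideanSpace ℝ (Fin d) → ℂ) : Prop where
  continuous : Continuous ψ
  map_zero : ψ 0 = 0
  charFun_eq : ∀ z, charFun (P.map (X (1, 1))) z = Complex.exp (ψ z)

/-- `X` is deterministic: `X_t` has a degenerate distribution for some `t` with positive
coordinates. -/
def IsDeterministicSheet (P : Measure Ω) (X : Quarter → Ω → EuclideanSpace ℝ (Fin d)) : Prop :=
  ∃ t : Quarter, 0 < t.1 ∧ 0 < t.2 ∧
    ∃ c : EuclideanSpace ℝ (Fin d), P.map (X t) = Measure.dirac c

/-- `X` is symmetric: the processes `X` and `-X` are identical in law (as random elements of the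
product space `(ℝ^d)^([0,∞)²)`, i.e. they have the same finite-dimensional distributions). -/
def IsSymmetric (P : Measure Ω) (X : Quarter → Ω → EuclideanSpace ℝ (Fin d)) : Prop :=
  IdentDistrib (fun ω (t : Quarter) => X t ω) (fun ω (t : Quarter) => -X t ω) P P

/-- The process `X` along the path `(x, y)`. -/
def along (X : Quarter → Ω → EuclideanSpace ℝ (Fin d)) (x y : ℝ → ℝ≥0) (t : ℝ) (ω : Ω) :
    EuclideanSpace ℝ (Fin d) :=
  X (x t, y t) ω

/-- Stationary increments on `T`: the law of `Y_t - Y_s` (`s < t` in `T`) depends only on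
`t - s`. -/
def HasStationaryIncrements (P : Measure Ω) (T : Set ℝ)
    (Y : ℝ → Ω → EuclideanSpace ℝ (Fin d)) : Prop :=
  ∀ s ∈ T, ∀ t ∈ T, ∀ s' ∈ T, ∀ t' ∈ T, s < t → t' - s' = t - s →
    IdentDistrib (fun ω => Y t ω - Y s ω) (fun ω => Y t' ω - Y s' ω) P P

/-- For all `s < t` in `T`, the increment `Y_t - Y_s` has characteristic function
`z ↦ exp (φ (t - s) * η z)`. -/
def HasIncrementCharFun (P : Measure Ω) (T : Set ℝ) (Y : ℝ → Ω → EuclideanSpace ℝ (Fin d))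
    (φ : ℝ → ℝ) (η : EuclideanSpace ℝ (Fin d) → ℂ) : Prop :=
  ∀ s ∈ T, ∀ t ∈ T, s < t → ∀ z : EuclideanSpace ℝ (Fin d),
    charFun (P.map (fun ω => Y t ω - Y s ω)) z = Complex.exp ((φ (t - s) : ℂ) * η z)

end Sheets

/-- `(x(t), y(t))`, `t ∈ T`, is a decreasing path in `[0,∞)²`. Only the values of `x` and `y` on the
interval `T` matter. -/
structure IsDecreasingPath (T : Set ℝ) (x y : ℝ → ℝ≥0) : Prop where
  interval : T.OrdConnected
  monotone_x : MonotoneOn x T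
  antitone_y : AntitoneOn y T
  continuous_x : ContinuousOn x T
  continuous_y : ContinuousOn y T
  pos_x : ∀ t ∈ interior T, 0 < x t
  pos_y : ∀ t ∈ interior T, 0 < y t
  nonconstant : (∃ s ∈ T, ∃ t ∈ T, x s ≠ x t) ∨ (∃ s ∈ T, ∃ t ∈ T, y s ≠ y t)

/-- Family (i): vertical or horizontal paths with constant speed. -/
def FamilyI (T : Set ℝ) (x y : ℝ → ℝ≥0) (a b c : ℝ) : Prop :=
  0 < a ∧ 0 < c ∧
    ((∀ t ∈ T, (x t : ℝ) = a ∧ (y t : ℝ) = b - c * t) ∨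
      (∀ t ∈ T, (x t : ℝ) = b + c * t ∧ (y t : ℝ) = a))

/-- Family (ii): first vertical, then horizontal, turning at the interior time `σ`. -/
def FamilyII (T : Set ℝ) (x y : ℝ → ℝ≥0) (σ a b c d : ℝ) : Prop :=
  σ ∈ interior T ∧ 0 < a ∧ 0 < b ∧ 0 < c ∧ 0 < d ∧ a * c = b * d ∧
    ∀ t ∈ T, (x t : ℝ) = a + d * (t - σ) * (if σ < t then 1 else 0) ∧
      (y t : ℝ) = b - c * (t - σ) * (if t ≤ σ then 1 else 0)

/-- Family (iii): oblique straight lines with constant speed. -/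
def FamilyIII (T : Set ℝ) (x y : ℝ → ℝ≥0) (a b c d : ℝ) : Prop :=
  0 < b ∧ 0 < d ∧ ∀ t ∈ T, (x t : ℝ) = a + b * t ∧ (y t : ℝ) = c - d * t

/-- Family (iv): exponential parametrizations of hyperbolas. -/
def FamilyIV (T : Set ℝ) (x y : ℝ → ℝ≥0) (a b c : ℝ) : Prop :=
  0 < a ∧ 0 < b ∧ 0 < c ∧
    ∀ t ∈ T, (x t : ℝ) = a * Real.exp (c * t) ∧ (y t : ℝ) = b * Real.exp (-(c * t))

end LevySheet

open LevySheet

namespace LevySheet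

/-! For `s < t` the points of a decreasing path are ordered from upper left to lower right, so the
increment of the sheet between them is its increment over a rectangle of area `A = (x t - x s) * y
t` minus its increment over a disjoint rectangle of area `B = x s * (y s - y t)`. By independence
and bilinearity of the exponent in the two parameters, its characteristic function is `exp (A * ψ z
+ B * ψ (-z))` (`charFun_along`). Distinguished logarithms are unique, so stationarity means that `A
* ψ z + B * ψ (-z)` depends only on `t - s`. Since `ψ (-z)` is the conjugate of `ψ z` and `Re ψ` is
not identically zero, the swept area `A + B` depends only on `t - s`. If `X` is not symmetric, `Im
ψ` is not identically zero either, so `A - B`, hence `A` alone, has the same property; this excludes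
families (ii) and (iii).

What remains is deterministic: to find the paths whose swept area is stationary. For `a < s < b` the
defect of additivity of the area is `2 * (x s - x a) * (y s - y b)`, so this product is invariant
under time shifts (`mul_shift`). If `x` or `y` is flat on some interval, the product vanishes on all
short windows, which forces `y` to be frozen once `x` has moved: the path is vertical, horizontal,
or turns once (`turning`). If both are strictly monotone, a point of differentiability of `x`,
supplied by Lebesgue's theorem, is carried to every other point by the product identity, and one
obtains `x'' = k * x'`, and by time reversal `y'' = -k * y'`. The case `k = 0` gives straight lines;
for `k ≠ 0` stationarity kills the additive constants and leaves the hyperbolas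
(`oblique_or_hyperbolic`). -/

/-- The area swept by the decreasing path `(x, y)` between the times `s` and `t`. -/
def sweptArea (x y : ℝ → ℝ) (s t : ℝ) : ℝ := (x t - x s) * y t + x s * (y s - y t)

/-- A positive continuous decreasing path on an open interval along which the swept area over
`(s, t)` depends only on `t - s`. -/
structure IsStationaryPath (I : Set ℝ) (x y : ℝ → ℝ) : Prop where
  isOpen : IsOpen I
  ordConnected : I.OrdConnected
  mono : MonotoneOn x I
  anti : AntitoneOn y I
  cont_x : ContinuousOn x I
  cont_y : ContinuousOn y I
  pos_x : ∀ t ∈ I, 0 < x t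
  pos_y : ∀ t ∈ I, 0 < y t
  stat : ∀ s t r, s ∈ I → t ∈ I → s + r ∈ I → t + r ∈ I → s < t →
    sweptArea x y (s + r) (t + r) = sweptArea x y s t
  nonconst : ¬ ∀ s ∈ I, ∀ t ∈ I, x s = x t ∧ y s = y t

/-! ### Calculus on intervals. -/

theorem eq_of_locally_eq {I : Set ℝ} (hI : IsOpen I) (hc : I.OrdConnected) {f : ℝ → ℝ}
    (h : ∀ c ∈ I, ∀ᶠ t in 𝓝 c, f t = f c) {s t : ℝ} (hs : s ∈ I) (ht : t ∈ I) : f s = f t := by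
  have hd : ∀ c ∈ I, HasDerivAt f 0 c := fun c hcI =>
    (hasDerivAt_const c (f c)).congr_of_eventuallyEq (h c hcI)
  exact hI.is_const_of_deriv_eq_zero hc.isPreconnected
    (fun c hcI => (hd c hcI).differentiableAt.differentiableWithinAt)
    (fun c hcI => (hd c hcI).deriv) hs ht

theorem eq_affine_of_hasDerivAt {I : Set ℝ} (hI : IsOpen I) (hc : I.OrdConnected) {f : ℝ → ℝ}
    {m : ℝ} (h : ∀ t ∈ I, HasDerivAt f m t) : ∃ c, ∀ t ∈ I, f t = c + m * t := by
  have hd : ∀ t ∈ I, HasDerivAt (fun t => f t - m * t) 0 t := fun t ht => by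
    have := (h t ht).sub ((hasDerivAt_id' t).const_mul m)
    rwa [mul_one, sub_self] at this
  obtain ⟨c, hc⟩ := hI.exists_is_const_of_deriv_eq_zero hc.isPreconnected
    (fun t ht => (hd t ht).differentiableAt.differentiableWithinAt)
    (fun t ht => (hd t ht).deriv)
  exact ⟨c, fun t ht => by linarith [hc t ht]⟩

theorem exists_differentiableAt_of_monotoneOn {I : Set ℝ} (hI : IsOpen I) (hne : I.Nonempty)
    {f : ℝ → ℝ} (hf : MonotoneOn f I) : ∃ t ∈ I, DifferentiableAt ℝ f t := by
  have h := hf.ae_differentiableWithinAt_of_mem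
  by_contra! hcon
  have : I ⊆ {t | ¬ (t ∈ I → DifferentiableWithinAt ℝ f I t)} := fun t ht hd =>
    hcon t ht ((hd ht).differentiableAt (hI.mem_nhds ht))
  exact (hI.measure_pos volume hne).ne' (measure_mono_null this h)

/-- A monotone function with stationary increments on an interval is affine. -/
theorem MonotoneOn.eq_affine_of_stationary {I : Set ℝ} (hI : IsOpen I) (hc : I.OrdConnected)
    {f : ℝ → ℝ} (hf : MonotoneOn f I)
    (h : ∀ s t r, s ∈ I → t ∈ I → s + r ∈ I → t + r ∈ I → s < t →
      f (t + r) - f (s + r) = f t - f s) : ∃ c m, ∀ t ∈ I, f t = c + m * t := by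
  rcases I.eq_empty_or_nonempty with rfl | hne
  · exact ⟨0, 0, by simp⟩
  obtain ⟨t₀, ht₀, hd⟩ := exists_differentiableAt_of_monotoneOn hI hne hf
  -- Near any `t`, `f` is a translate of `f` near `t₀` up to a constant, so the derivative at `t₀`
  -- is the derivative everywhere.
  obtain ⟨c, hc⟩ := eq_affine_of_hasDerivAt hI hc (f := f) (m := deriv f t₀) (fun t ht => by
    have hshift : HasDerivAt (fun τ => f (τ + (t₀ - t)) - f t₀ + f t) (deriv f t₀) t := by
      have : HasDerivAt f (deriv f t₀) (t + (t₀ - t)) := by simpa using hd.hasDerivAt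
      simpa using ((this.comp_add_const t (t₀ - t)).sub_const (f t₀)).add_const (f t)
    refine hshift.congr_of_eventuallyEq ?_
    have h2 : ∀ᶠ τ in 𝓝 t, τ + (t₀ - t) ∈ I :=
      (continuous_add_const (t₀ - t)).continuousAt.eventually (hI.mem_nhds (by simpa using ht₀))
    filter_upwards [hI.mem_nhds ht, h2] with τ hτ hτ'
    rcases lt_trichotomy τ t with hlt | rfl | hlt
    · have := h τ t (t₀ - t) hτ ht hτ' (by simpa using ht₀) hlt
      simp only [add_sub_cancel] at this
      linarith
    · simp
    · have := h t τ (t₀ - t) ht hτ (by simpa using ht₀) hτ' hlt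
      simp only [add_sub_cancel] at this
      linarith)
  exact ⟨c, _, hc⟩

theorem eqOn_of_eqOn_interior {T : Set ℝ} (hT : T.OrdConnected) (hne : (interior T).Nonempty)
    {f g : ℝ → ℝ} (hf : ContinuousOn f T) (hg : ContinuousOn g T)
    (h : ∀ t ∈ interior T, f t = g t) {t : ℝ} (ht : t ∈ T) : f t = g t := by
  have hcl : T ⊆ closure (interior T) := by
    rw [(Set.OrdConnected.convex (𝕜 := ℝ) hT).closure_interior_eq_closure_of_nonempty_interior hne]
    exact subset_closure
  exact Set.EqOn.of_subset_closure (fun t ht => h t ht) hf hg interior_subset hcl ht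

/-! ### Paths with stationary swept area: basic identities. -/

namespace IsStationaryPath

variable {I : Set ℝ} {x y : ℝ → ℝ}

/-- Reversing time and exchanging the axes maps decreasing paths to decreasing paths with the same
swept area, so each statement about `x` yields one about `y`. -/
theorem reverse (h : IsStationaryPath I x y) :
    IsStationaryPath (Neg.neg ⁻¹' I) (fun t => y (-t)) (fun t => x (-t)) where
  isOpen := h.isOpen.preimage continuous_neg
  ordConnected := ⟨fun a ha b hb c hc =>
    h.ordConnected.out hb ha ⟨neg_le_neg hc.2, neg_le_neg hc.1⟩⟩
  mono := fun _ ha _ hb hab => h.anti hb ha (neg_le_neg hab)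
  anti := fun _ ha _ hb hab => h.mono hb ha (neg_le_neg hab)
  cont_x := h.cont_y.comp continuous_neg.continuousOn fun _ ht => ht
  cont_y := h.cont_x.comp continuous_neg.continuousOn fun _ ht => ht
  pos_x := fun t ht => h.pos_y (-t) ht
  pos_y := fun t ht => h.pos_x (-t) ht
  stat := fun s t r hs ht hsr htr hst => by
    have := h.stat (-t) (-s) (-r) ht hs (by simpa [add_comm] using htr)
      (by simpa [add_comm] using hsr) (neg_lt_neg hst)
    simp only [sweptArea, neg_add] at this ⊢
    linarith
  nonconst := fun hc => h.nonconst fun s hs t ht => by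
    have := hc (-s) (by simpa using hs) (-t) (by simpa using ht)
    simp only [neg_neg] at this
    exact this.symm

theorem sweptArea_nonneg (h : IsStationaryPath I x y) {s t : ℝ} (hs : s ∈ I) (ht : t ∈ I)
    (hst : s ≤ t) : 0 ≤ sweptArea x y s t :=
  add_nonneg (mul_nonneg (sub_nonneg.2 (h.mono hs ht hst)) (h.pos_y t ht).le)
    (mul_nonneg (h.pos_x s hs).le (sub_nonneg.2 (h.anti hs ht hst)))

theorem eq_of_sweptArea_eq_zero (h : IsStationaryPath I x y) {s t : ℝ} (hs : s ∈ I) (ht : t ∈ I)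
    (hst : s ≤ t) (h0 : sweptArea x y s t = 0) : x s = x t ∧ y s = y t := by
  have h1 := mul_nonneg (sub_nonneg.2 (h.mono hs ht hst)) (h.pos_y t ht).le
  have h2 := mul_nonneg (h.pos_x s hs).le (sub_nonneg.2 (h.anti hs ht hst))
  unfold sweptArea at h0
  have h3 : (x t - x s) * y t = 0 := by linarith
  have h4 : x s * (y s - y t) = 0 := by linarith
  rcases mul_eq_zero.1 h3 with h5 | h5
  · rcases mul_eq_zero.1 h4 with h6 | h6
    · exact absurd h6 (h.pos_x s hs).ne'
    · exact ⟨by linarith, by linarith⟩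
  · exact absurd h5 (h.pos_y t ht).ne'

/-- A zero area freezes the path on `[s, t]`; by stationarity it is then frozen on a short window
around every point, hence constant on `I`. -/
theorem sweptArea_pos (h : IsStationaryPath I x y) {s t : ℝ} (hs : s ∈ I) (ht : t ∈ I)
    (hst : s < t) : 0 < sweptArea x y s t := by
  refine (h.sweptArea_nonneg hs ht hst.le).lt_of_ne fun h0 => h.nonconst ?_
  obtain ⟨hx, hy⟩ := h.eq_of_sweptArea_eq_zero hs ht hst.le h0.symm
  have key : ∀ c ∈ I, ∀ᶠ τ in 𝓝 c, x τ = x c ∧ y τ = y c := by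
    intro c hc
    obtain ⟨ε, hε, hball⟩ := Metric.isOpen_iff.1 h.isOpen c hc
    -- The window of length `2 * δ` around `c` stays in `I`, and its translate starting at `s` stays
    -- in `[s, t]`.
    set δ := min (ε / 2) ((t - s) / 2) with hδ
    have hδ0 : 0 < δ := lt_min (by linarith) (by linarith)
    have hδ1 : δ ≤ ε / 2 := min_le_left _ _
    have hδ2 : δ ≤ (t - s) / 2 := min_le_right _ _
    have hm1 : c - δ ∈ I := hball (by
      rw [Metric.mem_ball, Real.dist_eq, abs_lt]; constructor <;> linarith)
    have hm2 : c + δ ∈ I := hball (by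
      rw [Metric.mem_ball, Real.dist_eq, abs_lt]; constructor <;> linarith)
    have hs' : s + 2 * δ ∈ I := h.ordConnected.out hs ht ⟨by linarith, by linarith⟩
    have e1 : x (s + 2 * δ) = x s := le_antisymm
      (hx ▸ h.mono hs' ht (by linarith)) (h.mono hs hs' (by linarith))
    have e2 : y (s + 2 * δ) = y s := le_antisymm
      (h.anti hs hs' (by linarith)) (hy ▸ h.anti hs' ht (by linarith))
    have e3 := h.stat s (s + 2 * δ) (c - δ - s) hs hs' (by simpa using hm1)
      (by convert hm2 using 1; ring) (by linarith)
    rw [show s + (c - δ - s) = c - δ by ring, show s + 2 * δ + (c - δ - s) = c + δ by ring] at e3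
    have e4 : sweptArea x y s (s + 2 * δ) = 0 := by simp [sweptArea, e1, e2]
    obtain ⟨e5, e6⟩ := h.eq_of_sweptArea_eq_zero hm1 hm2 (by linarith) (e3.trans e4)
    have hfl : ∀ τ ∈ Set.Icc (c - δ) (c + δ), x τ = x (c - δ) ∧ y τ = y (c - δ) := by
      intro τ hτ
      have hτI := h.ordConnected.out hm1 hm2 hτ
      exact ⟨le_antisymm (e5 ▸ h.mono hτI hm2 hτ.2) (h.mono hm1 hτI hτ.1),
        le_antisymm (h.anti hm1 hτI hτ.1) (e6 ▸ h.anti hτI hm2 hτ.2)⟩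
    have hcc := hfl c ⟨by linarith, by linarith⟩
    filter_upwards [Icc_mem_nhds (by linarith : c - δ < c) (by linarith : c < c + δ)] with τ hτ
    exact ⟨(hfl τ hτ).1.trans hcc.1.symm, (hfl τ hτ).2.trans hcc.2.symm⟩
  intro a ha b hb
  exact ⟨eq_of_locally_eq h.isOpen h.ordConnected (fun c hc => (key c hc).mono fun _ h => h.1)
      ha hb,
    eq_of_locally_eq h.isOpen h.ordConnected (fun c hc => (key c hc).mono fun _ h => h.2) ha hb⟩

/-- Area of `(a, s)` plus area of `(s, b)` minus area of `(a, b)` is twice this product, and each of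
the three areas is shift invariant. -/
theorem mul_shift (h : IsStationaryPath I x y) {a s b r : ℝ} (ha : a ∈ I) (hb : b ∈ I)
    (har : a + r ∈ I) (hbr : b + r ∈ I) (has : a < s) (hsb : s < b) :
    (x (s + r) - x (a + r)) * (y (s + r) - y (b + r)) = (x s - x a) * (y s - y b) := by
  have hs := h.ordConnected.out ha hb ⟨has.le, hsb.le⟩
  have hsr := h.ordConnected.out har hbr ⟨add_le_add_left has.le r, add_le_add_left hsb.le r⟩
  have h1 := h.stat a s r ha hs har hsr has
  have h2 := h.stat s b r hs hb hsr hbr hsb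
  have h3 := h.stat a b r ha hb har hbr (has.trans hsb)
  unfold sweptArea at h1 h2 h3
  linarith

/-! ### Degenerate paths: vertical, horizontal and turning. -/

/-- A window no longer than the flat piece `[p, q]` of `x` can be shifted into it, where the product
of `mul_shift` vanishes. -/
theorem locally_degenerate (h : IsStationaryPath I x y) {p q : ℝ} (hp : p ∈ I) (hq : q ∈ I)
    (hx : x p = x q) {a s b : ℝ} (ha : a ∈ I) (hb : b ∈ I) (has : a < s)
    (hsb : s < b) (hab : b - a ≤ q - p) : x a = x s ∨ y s = y b := by
  have hb' : b + (p - a) ∈ I := h.ordConnected.out hp hq ⟨by linarith, by linarith⟩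
  have hs' : s + (p - a) ∈ I := h.ordConnected.out hp hq ⟨by linarith, by linarith⟩
  have key := h.mul_shift ha hb (r := p - a) (by simpa using hp) hb' has hsb
  have e : x (s + (p - a)) = x (a + (p - a)) := by
    rw [add_sub_cancel]
    exact le_antisymm (hx ▸ h.mono hs' hq (by linarith)) (h.mono hp hs' (by linarith))
  rw [e, sub_self, zero_mul] at key
  rcases mul_eq_zero.1 key.symm with h1 | h1
  · exact Or.inl (by linarith)
  · exact Or.inr (by linarith)

/-- Passing from short windows to all windows: once `x` has moved, `y` stops, and the stop
propagates, because wherever `y` is at rest the positive swept area keeps `x` moving. -/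
theorem degenerate_of_locally_degenerate (h : IsStationaryPath I x y) {δ : ℝ} (hδ : 0 < δ)
    (hloc : ∀ a s b, a ∈ I → b ∈ I → a < s → s < b → b - a ≤ δ → x a = x s ∨ y s = y b)
    {a s t b : ℝ} (ha : a ∈ I) (hb : b ∈ I) (has : a < s) (hst : s ≤ t) (htb : t < b) :
    x a = x s ∨ y t = y b := by
  refine or_iff_not_imp_left.2 fun hne => ?_
  have hab : Set.Icc a b ⊆ I := h.ordConnected.out ha hb
  have hcx : ContinuousOn x (Set.Icc a s) :=
    h.cont_x.mono ((Set.Icc_subset_Icc_right (by linarith)).trans hab)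
  have hcomp : IsCompact (Set.Icc a s ∩ x ⁻¹' {x a}) :=
    isCompact_Icc.of_isClosed_subset (hcx.preimage_isClosed_of_isClosed isClosed_Icc
      isClosed_singleton) Set.inter_subset_left
  -- `a₁` is the last time in `[a, s]` at which `x` still has its value at `a`; `x` moves
  -- immediately after it.
  obtain ⟨a₁, ⟨ha₁, hxa₁⟩, hmax⟩ := hcomp.exists_isGreatest ⟨a, ⟨le_rfl, has.le⟩, rfl⟩
  have ha₁s : a₁ < s := ha₁.2.lt_of_ne fun he => hne (he ▸ hxa₁.symm)
  set s₁ := min s (a₁ + δ / 2)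
  have hs₁s : s₁ ≤ s := min_le_left _ _
  have hs₁δ : s₁ ≤ a₁ + δ / 2 := min_le_right _ _
  have ha₁s₁ : a₁ < s₁ := lt_min ha₁s (by linarith)
  have hne₁ : x a₁ ≠ x s₁ := fun he =>
    (hmax ⟨⟨ha₁.1.trans ha₁s₁.le, hs₁s⟩, he.symm.trans hxa₁⟩).not_gt ha₁s₁
  have hs₁I : s₁ ∈ I := hab ⟨ha₁.1.trans ha₁s₁.le, by linarith⟩
  have hclosed : IsClosed ({c | y c = y s₁} ∩ Set.Icc s₁ b) := by
    rw [Set.inter_comm]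
    exact (h.cont_y.mono (h.ordConnected.out hs₁I hb)).preimage_isClosed_of_isClosed isClosed_Icc
      isClosed_singleton
  -- Continuous induction to the right: the set where `y` equals `y s₁` is closed in `[s₁, b]` and
  -- extends beyond each of its points.
  have hsub := hclosed.Icc_subset_of_forall_mem_nhdsWithin (a := s₁) rfl (by
    rintro c ⟨hc, hc1, hc2⟩
    have hcI : c ∈ I := h.ordConnected.out hs₁I hb ⟨hc1, hc2.le⟩
    obtain ⟨a', ha'I, ha'c, ha'δ, hxa'⟩ : ∃ a' ∈ I, a' < c ∧ c - a' ≤ δ / 2 ∧ x a' ≠ x c := by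
      rcases hc1.eq_or_lt with rfl | hlt
      · exact ⟨a₁, hab ⟨ha₁.1, by linarith⟩, ha₁s₁, by linarith, hne₁⟩
      · have h1 : s₁ ≤ max s₁ (c - δ / 2) := le_max_left _ _
        have h2 : max s₁ (c - δ / 2) < c := max_lt hlt (by linarith)
        have hmI : max s₁ (c - δ / 2) ∈ I := h.ordConnected.out hs₁I hcI ⟨h1, h2.le⟩
        refine ⟨_, hmI, h2, by linarith [le_max_right s₁ (c - δ / 2)], fun he => ?_⟩
        have hye : y (max s₁ (c - δ / 2)) = y c :=
          le_antisymm ((h.anti hs₁I hmI h1).trans_eq hc.symm) (h.anti hmI hcI h2.le)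
        have := h.sweptArea_pos hmI hcI h2
        simp [sweptArea, he, hye] at this
    filter_upwards [Ioo_mem_nhdsGT (lt_min hc2 (by linarith : c < c + δ / 2))] with b' hb'
    have h1 := hb'.2.trans_le (min_le_left _ _)
    have h2 := hb'.2.trans_le (min_le_right _ _)
    have hb'I : b' ∈ I := h.ordConnected.out hcI hb ⟨hb'.1.le, h1.le⟩
    have := (hloc a' c b' ha'I hb'I ha'c hb'.1 (by linarith)).resolve_left hxa'
    exact this.symm.trans hc)
  have e1 : y t = y s₁ := hsub ⟨by linarith, htb.le⟩
  have e2 : y b = y s₁ := hsub ⟨by linarith, le_rfl⟩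
  rw [e1, e2]

theorem exists_lt (h : IsStationaryPath I x y) : ∃ s ∈ I, ∃ t ∈ I, s < t := by
  by_contra! hcon
  exact h.nonconst fun s hs t ht => by
    rw [le_antisymm (hcon t ht s hs) (hcon s hs t ht)]; exact ⟨rfl, rfl⟩

theorem exists_gt (h : IsStationaryPath I x y) {t : ℝ} (ht : t ∈ I) : ∃ b ∈ I, t < b := by
  obtain ⟨ε, hε, hb⟩ := Metric.isOpen_iff.1 h.isOpen t ht
  exact ⟨t + ε / 2, hb (by rw [Metric.mem_ball, Real.dist_eq, abs_lt]; constructor <;> linarith),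
    by linarith⟩

theorem exists_lt_of_mem (h : IsStationaryPath I x y) {t : ℝ} (ht : t ∈ I) : ∃ b ∈ I, b < t := by
  obtain ⟨ε, hε, hb⟩ := Metric.isOpen_iff.1 h.isOpen t ht
  exact ⟨t - ε / 2, hb (by rw [Metric.mem_ball, Real.dist_eq, abs_lt]; constructor <;> linarith),
    by linarith⟩

theorem y_affine_of_x_const (h : IsStationaryPath I x y) {J : Set ℝ} (hJ : IsOpen J)
    (hJc : J.OrdConnected) (hJI : J ⊆ I) {a : ℝ} (hx : ∀ t ∈ J, x t = a) (ha : 0 < a) :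
    ∃ b m, ∀ t ∈ J, y t = b - m * t := by
  obtain ⟨c, m, hcm⟩ := MonotoneOn.eq_affine_of_stationary hJ hJc (f := fun t => -y t)
    (fun s hs t ht hst => neg_le_neg (h.anti (hJI hs) (hJI ht) hst))
    (fun s t r hs ht hsr htr hst => by
      have := h.stat s t r (hJI hs) (hJI ht) (hJI hsr) (hJI htr) hst
      simp only [sweptArea, hx _ hs, hx _ ht, hx _ hsr, hx _ htr, sub_self, zero_mul,
        zero_add] at this
      linarith [mul_left_cancel₀ ha.ne' this])
  exact ⟨-c, m, fun t ht => by linarith [hcm t ht]⟩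

theorem vertical_of_x_const (h : IsStationaryPath I x y) (hx : ∀ s ∈ I, ∀ t ∈ I, x s = x t) :
    ∃ a b c : ℝ, 0 < a ∧ 0 < c ∧ ∀ t ∈ I, x t = a ∧ y t = b - c * t := by
  obtain ⟨s, hs, t, ht, hst⟩ := h.exists_lt
  obtain ⟨b, m, hm⟩ := h.y_affine_of_x_const h.isOpen h.ordConnected subset_rfl
    (fun t ht => hx t ht s hs) (h.pos_x s hs)
  refine ⟨x s, b, m, h.pos_x s hs, ?_, fun t ht => ⟨hx t ht s hs, hm t ht⟩⟩
  have := h.sweptArea_pos hs ht hst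
  rw [sweptArea, hx t ht s hs, hm s hs, hm t ht, sub_self, zero_mul, zero_add] at this
  have := (mul_pos_iff_of_pos_left (h.pos_x s hs)).1 this
  nlinarith

theorem y_affine_left (h : IsStationaryPath I x y) {σ : ℝ} (hσ : σ ∈ I)
    (hx : ∀ t ∈ I, t ≤ σ → x t = x σ) :
    ∃ c, 0 < c ∧ ∀ t ∈ I, t ≤ σ → y t = y σ - c * (t - σ) := by
  have hJI : I ∩ Set.Iio σ ⊆ I := Set.inter_subset_left
  obtain ⟨b, c, hc⟩ := h.y_affine_of_x_const (J := I ∩ Set.Iio σ)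
    (h.isOpen.inter isOpen_Iio) (h.ordConnected.inter Set.ordConnected_Iio) hJI
    (fun t ht => hx t ht.1 (le_of_lt ht.2)) (h.pos_x σ hσ)
  have key : ∀ t ∈ I, t ≤ σ → y t = y σ - c * (t - σ) := by
    intro t ht htσ
    rcases htσ.eq_or_lt with rfl | hlt
    · simp
    obtain ⟨t', ht', htt'⟩ := h.exists_lt_of_mem ht
    -- The endpoint `σ` is outside the open interval where `y` is known to be affine; shifting `(t,
    -- σ)` to the left brings both ends inside.
    have hσ' : σ + (t' - t) ∈ I := h.ordConnected.out ht' hσ ⟨by linarith, by linarith⟩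
    have := h.stat t σ (t' - t) ht hσ (by simpa using ht') hσ' hlt
    rw [sweptArea, sweptArea, add_sub_cancel, hx t ht htσ, hx t' ht' (by linarith),
      hx _ hσ' (by linarith), sub_self, zero_mul, zero_mul, zero_add, zero_add] at this
    have := mul_left_cancel₀ (h.pos_x σ hσ).ne' this
    rw [hc t' ⟨ht', by simp; linarith⟩, hc _ ⟨hσ', by simp; linarith⟩] at this
    linarith
  refine ⟨c, ?_, key⟩
  obtain ⟨s, hs, hsσ⟩ := h.exists_lt_of_mem hσ
  have := h.sweptArea_pos hs hσ hsσ
  rw [sweptArea, hx s hs hsσ.le, key s hs hsσ.le, sub_self, zero_mul, zero_add] at this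
  have := (mul_pos_iff_of_pos_left (h.pos_x σ hσ)).1 this
  nlinarith

theorem turning (h : IsStationaryPath I x y)
    (hdeg : ∀ a s t b, a ∈ I → b ∈ I → a < s → s ≤ t → t < b → x a = x s ∨ y t = y b)
    (hx : ¬ ∀ s ∈ I, ∀ t ∈ I, x s = x t) (hy : ¬ ∀ s ∈ I, ∀ t ∈ I, y s = y t) :
    ∃ σ ∈ I, ∃ a b c d : ℝ, 0 < a ∧ 0 < b ∧ 0 < c ∧ 0 < d ∧ a * c = b * d ∧
      ∀ t ∈ I, x t = a + d * max (t - σ) 0 ∧ y t = b - c * min (t - σ) 0 := by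
  obtain ⟨p, hp, q, hq, hpq, hxpq⟩ : ∃ p ∈ I, ∃ q ∈ I, p < q ∧ x p ≠ x q := by
    by_contra! hcon
    refine hx fun s hs t ht => ?_
    rcases lt_trichotomy s t with hst | rfl | hst
    · exact hcon s hs t ht hst
    · rfl
    · exact (hcon t ht s hs hst).symm
  obtain ⟨p', hp', q', hq', hpq', hypq⟩ : ∃ p ∈ I, ∃ q ∈ I, p < q ∧ y p ≠ y q := by
    by_contra! hcon
    refine hy fun s hs t ht => ?_
    rcases lt_trichotomy s t with hst | rfl | hst
    · exact hcon s hs t ht hst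
    · rfl
    · exact (hcon t ht s hs hst).symm
  -- The turning time is the supremum of the times up to which `x` has been constant; afterwards `x`
  -- has moved, so `y` is constant.
  set L := {c ∈ I | ∀ a ∈ I, a ≤ c → x a = x c} with hL
  have hp'L : p' ∈ L := by
    refine ⟨hp', fun a ha hap => ?_⟩
    rcases hap.eq_or_lt with rfl | hlt
    · rfl
    · exact (hdeg a p' p' q' ha hq' hlt le_rfl hpq').resolve_right hypq
  have hub : ∀ c ∈ L, c ≤ q := by
    intro c hc
    by_contra! hqc
    exact hxpq ((hc.2 p hp (hpq.le.trans hqc.le)).trans (hc.2 q hq hqc.le).symm)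
  set σ := sSup L with hσdef
  have hbdd : BddAbove L := ⟨q, hub⟩
  have hσI : σ ∈ I := h.ordConnected.out hp' hq ⟨le_csSup hbdd hp'L, csSup_le ⟨p', hp'L⟩ hub⟩
  have hleft : ∀ t ∈ I, t < σ → x t = x p' := by
    intro t ht htσ
    obtain ⟨c, hcL, htc⟩ := exists_lt_of_lt_csSup ⟨p', hp'L⟩ htσ
    rcases le_total p' t with h1 | h1
    · exact (hcL.2 t ht htc.le).trans (hcL.2 p' hp' (by linarith)).symm
    · exact hp'L.2 t ht h1
  have hcl : ∀ f : ℝ → ℝ, ContinuousOn f I → ∀ v, (∃ᶠ t in 𝓝 σ, f t = v) → f σ = v := by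
    intro f hf v hv
    exact (isClosed_singleton (x := v)).mem_of_frequently_of_tendsto hv
      (hf.continuousAt (h.isOpen.mem_nhds hσI))
  have hxσ : x σ = x p' := by
    refine hcl x h.cont_x _ ?_
    have h1 : ∀ᶠ t in 𝓝[<] σ, x t = x p' := by
      filter_upwards [self_mem_nhdsWithin,
        mem_nhdsWithin_of_mem_nhds (h.isOpen.mem_nhds hσI)] with t ht htI
      exact hleft t htI ht
    exact h1.frequently.filter_mono nhdsWithin_le_nhds
  have hxl : ∀ t ∈ I, t ≤ σ → x t = x σ := by
    intro t ht htσ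
    rcases htσ.eq_or_lt with rfl | hlt
    · rfl
    · rw [hleft t ht hlt, hxσ]
  have hright : ∀ t ∈ I, ∀ b ∈ I, σ < t → t ≤ b → y t = y b := by
    intro t ht b hb hσt htb
    rcases htb.eq_or_lt with rfl | htb
    · rfl
    have : t ∉ L := fun htL => (le_csSup hbdd htL).not_gt hσt
    obtain ⟨a, ha, hat, hne⟩ : ∃ a ∈ I, a ≤ t ∧ x a ≠ x t := by
      by_contra! hcon
      exact this ⟨ht, hcon⟩
    exact (hdeg a t t b ha hb (hat.lt_of_ne fun he => hne (he ▸ rfl)) le_rfl htb).resolve_left hne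
  have hyr : ∀ b ∈ I, σ ≤ b → y b = y σ := by
    intro b hb hσb
    rcases hσb.eq_or_lt with rfl | hσb
    · rfl
    refine (hcl y h.cont_y _ ?_).symm
    have h1 : ∀ᶠ t in 𝓝[>] σ, y t = y b := by
      filter_upwards [Ioo_mem_nhdsGT hσb] with t ht
      exact hright t (h.ordConnected.out hσI hb ⟨ht.1.le, ht.2.le⟩) b hb ht.1 ht.2.le
    exact h1.frequently.filter_mono nhdsWithin_le_nhds
  obtain ⟨c, hc, hyc⟩ := h.y_affine_left hσI hxl
  obtain ⟨d, hd, hxd⟩ := h.reverse.y_affine_left (σ := -σ) (by simpa using hσI)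
    (fun t ht htσ => by simpa using hyr (-t) ht (by linarith))
  have hxr : ∀ t ∈ I, σ ≤ t → x t = x σ + d * (t - σ) := by
    intro t ht hσt
    have := hxd (-t) (by simpa using ht) (by linarith)
    simp only [neg_neg] at this
    linarith
  refine ⟨σ, hσI, x σ, y σ, c, d, h.pos_x σ hσI, h.pos_y σ hσI, hc, hd, ?_, ?_⟩
  · obtain ⟨ε, hε, hb⟩ := Metric.isOpen_iff.1 h.isOpen σ hσI
    have h1 : σ - ε / 2 ∈ I :=
      hb (by rw [Metric.mem_ball, Real.dist_eq, abs_lt]; constructor <;> linarith)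
    have h2 : σ + ε / 2 ∈ I :=
      hb (by rw [Metric.mem_ball, Real.dist_eq, abs_lt]; constructor <;> linarith)
    -- Equal areas just before and just after the turn give `a * c = b * d`.
    have := h.stat (σ - ε / 2) σ (ε / 2) h1 hσI (by simpa using hσI) h2 (by linarith)
    rw [sub_add_cancel, sweptArea, sweptArea, hxr _ h2 (by linarith), hxl _ h1 (by linarith),
      hyr _ h2 (by linarith), hyc _ h1 (by linarith)] at this
    have : (ε / 2) * (x σ * c) = (ε / 2) * (y σ * d) := by linarith
    exact mul_left_cancel₀ (by positivity) this
  · intro t ht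
    rcases le_total t σ with h1 | h1
    · rw [max_eq_right (by linarith), min_eq_left (by linarith), hxl t ht h1, hyc t ht h1]
      simp
    · rw [max_eq_left (by linarith), min_eq_right (by linarith), hyr t ht h1, hxr t ht h1]
      simp

/-! ### Strictly monotone paths: oblique lines and hyperbolas. -/

theorem exists_shift_window (h : IsStationaryPath I x y) {p q : ℝ} (hp : p ∈ I) (hq : q ∈ I) :
    ∃ s b, p < s ∧ s < b ∧ b ∈ I ∧ b + (q - p) ∈ I := by
  obtain ⟨b, hb, hpb⟩ := h.exists_gt hp
  obtain ⟨b', hb', hqb⟩ := h.exists_gt hq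
  have h0 : 0 < min (b - p) (b' - q) := lt_min (by linarith) (by linarith)
  have h1 := min_le_left (b - p) (b' - q)
  have h2 := min_le_right (b - p) (b' - q)
  exact ⟨p + min (b - p) (b' - q) / 2, p + min (b - p) (b' - q), by linarith, by linarith,
    h.ordConnected.out hp hb ⟨by linarith, by linarith⟩,
    h.ordConnected.out hq hb' ⟨by linarith, by linarith⟩⟩

/-- With `s` and `b` fixed, `mul_shift` makes `x (τ + r)` an affine function of `x τ` for `τ` near
`p`, so differentiability travels from `p` to `p + r`. -/
theorem hasDerivAt_shift (h : IsStationaryPath I x y) (hy : StrictAntiOn y I) {p r s b D : ℝ}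
    (hp : p ∈ I) (hpr : p + r ∈ I) (hps : p < s) (hsb : s < b) (hb : b ∈ I) (hbr : b + r ∈ I)
    (hD : HasDerivAt x D p) :
    HasDerivAt x ((y s - y b) / (y (s + r) - y (b + r)) * D) (p + r) := by
  set m := (y s - y b) / (y (s + r) - y (b + r)) with hm
  have hsrI : s + r ∈ I := h.ordConnected.out hpr hbr ⟨by linarith, by linarith⟩
  have hY' : 0 < y (s + r) - y (b + r) := sub_pos.2 (hy hsrI hbr (by linarith))
  have hloc : ∀ τ ∈ I, τ + r ∈ I → τ < s → x (τ + r) = x (s + r) - m * (x s - x τ) := by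
    intro τ hτ hτr hτs
    have := h.mul_shift hτ hb hτr hbr hτs hsb
    rw [hm]
    field_simp
    linarith
  have hev : ∀ᶠ t in 𝓝 (p + r), t - r ∈ I ∧ t ∈ I ∧ t - r < s := by
    have hc : Tendsto (fun t => t - r) (𝓝 (p + r)) (𝓝 p) := by
      have := (continuous_sub_right r).tendsto (p + r)
      simpa using this
    exact (hc.eventually (h.isOpen.mem_nhds hp)).and
      ((h.isOpen.eventually_mem hpr).and (hc.eventually (gt_mem_nhds hps)) )
  have hd : HasDerivAt (fun t => x (s + r) - m * (x s - x (t - r))) (m * D) (p + r) := by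
    have h1 : HasDerivAt x D (p + r - r) := by simpa using hD
    have := (((h1.comp_sub_const (p + r) r).const_sub (x s)).const_mul m).const_sub (x (s + r))
    exact this.congr_deriv (by ring)
  refine hd.congr_of_eventuallyEq (hev.mono fun t ht => ?_)
  have := hloc (t - r) ht.1 (by simpa using ht.2.1) ht.2.2
  simpa using this

theorem differentiableAt (h : IsStationaryPath I x y) (hy : StrictAntiOn y I) {t : ℝ}
    (ht : t ∈ I) : DifferentiableAt ℝ x t := by
  obtain ⟨p, hp, hd⟩ := exists_differentiableAt_of_monotoneOn h.isOpen ⟨t, ht⟩ h.mono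
  obtain ⟨s, b, hps, hsb, hb, hb'⟩ := h.exists_shift_window hp ht
  have := h.hasDerivAt_shift hy (r := t - p) hp (by simpa using ht) hps hsb hb hb' hd.hasDerivAt
  rw [add_sub_cancel] at this
  exact this.differentiableAt

theorem deriv_shift (h : IsStationaryPath I x y) (hy : StrictAntiOn y I) {p r s b : ℝ}
    (hp : p ∈ I) (hpr : p + r ∈ I) (hps : p < s) (hsb : s < b) (hb : b ∈ I) (hbr : b + r ∈ I) :
    deriv x (p + r) * (y (s + r) - y (b + r)) = deriv x p * (y s - y b) := by
  have := (h.hasDerivAt_shift hy hp hpr hps hsb hb hbr (h.differentiableAt hy hp).hasDerivAt).deriv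
  have hsrI : s + r ∈ I := h.ordConnected.out hpr hbr ⟨by linarith, by linarith⟩
  have hY' : 0 < y (s + r) - y (b + r) := sub_pos.2 (hy hsrI hbr (by linarith))
  rw [this]
  field_simp

/-- By `deriv_shift` a single zero of the derivative would spread to all of `I` and make `x`
constant. -/
theorem deriv_pos (h : IsStationaryPath I x y) (hx : StrictMonoOn x I) (hy : StrictAntiOn y I)
    {t : ℝ} (ht : t ∈ I) : 0 < deriv x t := by
  have hnn : 0 ≤ deriv x t := by
    rw [← derivWithin_of_isOpen h.isOpen ht]
    exact h.mono.derivWithin_nonneg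
  refine hnn.lt_of_ne fun h0 => ?_
  have hall : ∀ q ∈ I, deriv x q = 0 := by
    intro q hq
    obtain ⟨s, b, hts, hsb, hb, hb'⟩ := h.exists_shift_window ht hq
    have := h.deriv_shift hy (r := q - t) ht (by simpa using hq) hts hsb hb hb'
    rw [← h0, zero_mul, add_sub_cancel] at this
    refine (mul_eq_zero.1 this).resolve_right ?_
    have : s + (q - t) ∈ I := h.ordConnected.out hq hb' ⟨by linarith, by linarith⟩
    exact (sub_pos.2 (hy this hb' (by linarith))).ne'
  obtain ⟨s, hs, q, hq, hsq⟩ := h.exists_lt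
  have := h.isOpen.is_const_of_deriv_eq_zero h.ordConnected.isPreconnected
    (fun c hc => (h.differentiableAt hy hc).differentiableWithinAt) hall hs hq
  exact (hx hs hq hsq).ne this

/-- Eliminating the increments of `y` between `deriv_shift` and `mul_shift` expresses `deriv x t`,
for `t` near `p`, as `deriv x p` times a quotient of increments of `x`, which is differentiable in
`t`. The factor in front of `deriv x p` does not involve `p`: this is the equation `x'' = k * x'`.
-/
theorem hasDerivAt_deriv (h : IsStationaryPath I x y)
    (hx : StrictMonoOn x I) (hy : StrictAntiOn y I) {a s p : ℝ} (ha : a ∈ I) (hs : s ∈ I)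
    (has : a < s) (hp : p ∈ I) (hps : p < s) :
    HasDerivAt (deriv x) ((deriv x s - deriv x a) / (x s - x a) * deriv x p) p := by
  obtain ⟨b, hb, hsb⟩ := h.exists_gt hs
  have hX : 0 < x s - x a := sub_pos.2 (hx ha hs has)
  have hev : ∀ᶠ t in 𝓝 p, t ∈ I ∧ a + (t - p) ∈ I ∧ b + (t - p) ∈ I := by
    have hc : ∀ c ∈ I, ∀ᶠ t in 𝓝 p, c + (t - p) ∈ I := fun c hc => by
      have : Tendsto (fun t => c + (t - p)) (𝓝 p) (𝓝 c) := by
        have : Continuous fun t => c + (t - p) := by fun_prop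
        simpa using this.tendsto p
      exact this.eventually (h.isOpen.mem_nhds hc)
    exact (h.isOpen.eventually_mem hp).and ((hc a ha).and (hc b hb))
  have hd : HasDerivAt (fun t => deriv x p * ((x (s + (t - p)) - x (a + (t - p))) / (x s - x a)))
      ((deriv x s - deriv x a) / (x s - x a) * deriv x p) p := by
    have h1 : ∀ c ∈ I, HasDerivAt (fun t => x (c + (t - p))) (deriv x c) p := fun c hc => by
      have h2 : HasDerivAt x (deriv x c) (c + (p - p)) := by
        simpa using (h.differentiableAt hy hc).hasDerivAt
      have h3 : HasDerivAt (fun t : ℝ => c + (t - p)) 1 p :=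
        ((hasDerivAt_id' p).sub_const p).const_add c
      exact (h2.comp p h3).congr_deriv (mul_one _)
    have := (((h1 s hs).sub (h1 a ha)).div_const (x s - x a)).const_mul (deriv x p)
    exact this.congr_deriv (by ring)
  refine hd.congr_of_eventuallyEq (hev.mono fun t ⟨ht, hat, hbt⟩ => ?_)
  have h1 := h.deriv_shift hy (r := t - p) hp (by simpa using ht) hps hsb hb hbt
  have h2 := h.mul_shift ha hb hat hbt has hsb
  have hsI : s + (t - p) ∈ I := h.ordConnected.out hat hbt ⟨by linarith, by linarith⟩
  have hY' : 0 < y (s + (t - p)) - y (b + (t - p)) := sub_pos.2 (hy hsI hbt (by linarith))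
  have hY : 0 < y s - y b := sub_pos.2 (hy hs hb hsb)
  rw [add_sub_cancel] at h1
  rw [eq_comm]
  beta_reduce
  rw [← mul_div_assoc, div_eq_iff hX.ne']
  refine mul_right_cancel₀ (mul_pos hY hY').ne' ?_
  linear_combination (deriv x p) * (y s - y b) * h2 - (x s - x a) * (y s - y b) * h1

theorem hasDerivAt_exp (h : IsStationaryPath I x y)
    (hx : StrictMonoOn x I) (hy : StrictAntiOn y I) :
    ∃ C k : ℝ, 0 < C ∧ ∀ t ∈ I, HasDerivAt x (C * Real.exp (k * t)) t := by
  obtain ⟨p, hp, -⟩ := h.exists_lt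
  set k := deriv (deriv x) p / deriv x p with hk
  have hD : ∀ t ∈ I, HasDerivAt (deriv x) (k * deriv x t) t := by
    intro t ht
    -- A common `s` to the right of both `p` and `t` shows that the rate at `t` is the rate `k` at
    -- `p`.
    have hm : max p t ∈ I := by rcases max_choice p t with e | e <;> rw [e] <;> assumption
    obtain ⟨s, hs, hms⟩ := h.exists_gt hm
    have hps := (le_max_left p t).trans_lt hms
    have hts := (le_max_right p t).trans_lt hms
    have h1 := h.hasDerivAt_deriv hx hy hp hs hps hp hps
    have h2 := h.hasDerivAt_deriv hx hy hp hs hps ht hts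
    have : k = (deriv x s - deriv x p) / (x s - x p) := by
      rw [hk, h1.deriv, mul_div_assoc, div_self (h.deriv_pos hx hy hp).ne', mul_one]
    rw [this]
    exact h2
  have hE : ∀ t : ℝ, HasDerivAt (fun t => Real.exp (-(k * t))) (-k * Real.exp (-(k * t))) t := by
    intro t
    have : HasDerivAt (fun t => -(k * t)) (-(k * 1)) t := ((hasDerivAt_id' t).const_mul k).neg
    exact this.exp.congr_deriv (by ring)
  have hQ : ∀ t ∈ I, HasDerivAt (fun t => deriv x t * Real.exp (-(k * t))) 0 t := by
    intro t ht
    exact ((hD t ht).mul (hE t)).congr_deriv (by ring)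
  obtain ⟨C, hC⟩ := h.isOpen.exists_is_const_of_deriv_eq_zero h.ordConnected.isPreconnected
    (fun t ht => (hQ t ht).differentiableAt.differentiableWithinAt) (fun t ht => (hQ t ht).deriv)
  refine ⟨C, k, ?_, fun t ht => ?_⟩
  · rw [← hC p hp]
    exact mul_pos (h.deriv_pos hx hy hp) (Real.exp_pos _)
  · have : C * Real.exp (k * t) = deriv x t := by
      rw [← hC t ht, mul_assoc, ← Real.exp_add]
      simp
    rw [this]
    exact (h.differentiableAt hy ht).hasDerivAt

theorem exists_common_rate (h : IsStationaryPath I x y)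
    (hx : StrictMonoOn x I) (hy : StrictAntiOn y I) :
    ∃ C D k : ℝ, 0 < C ∧ 0 < D ∧ (∀ t ∈ I, HasDerivAt x (C * Real.exp (k * t)) t) ∧
      ∀ t ∈ I, HasDerivAt y (-(D * Real.exp (-(k * t)))) t := by
  obtain ⟨C, k, hC, hxd⟩ := h.hasDerivAt_exp hx hy
  obtain ⟨D, l, hD, hyd'⟩ := h.reverse.hasDerivAt_exp
    (fun s hs t ht hst => hy ht hs (neg_lt_neg hst))
    (fun s hs t ht hst => hx ht hs (neg_lt_neg hst))
  have hyd : ∀ t ∈ I, HasDerivAt y (-(D * Real.exp (-(l * t)))) t := by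
    intro t ht
    have h1 := hyd' (-t) (by simpa using ht)
    have := h1.comp t (hasDerivAt_neg t)
    have e : ((fun t => y (-t)) ∘ Neg.neg) = y := by ext; simp
    rw [e] at this
    exact this.congr_deriv (by rw [mul_neg l t]; ring)
  obtain ⟨p, hp, w, hw, hpw⟩ := h.exists_lt
  set r := (w - p) / 4 with hr
  have hr0 : 0 < r := by rw [hr]; linarith
  have hmem : ∀ c, p ≤ c → c ≤ w → c ∈ I := fun c h1 h2 => h.ordConnected.out hp hw ⟨h1, h2⟩
  -- This is `deriv_shift` with `s = p + r`, differentiated in `b` at `p + 2 * r`; the choice of `r`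
  -- keeps all the times in `[p, w]`.
  have key : C * Real.exp (k * (p + r)) * -(D * Real.exp (-(l * (p + 2 * r + r)))) =
      C * Real.exp (k * p) * -(D * Real.exp (-(l * (p + 2 * r)))) := by
    have h1 : HasDerivAt (fun b => C * Real.exp (k * (p + r)) * (y (p + r + r) - y (b + r)))
        (C * Real.exp (k * (p + r)) * -(-(D * Real.exp (-(l * (p + 2 * r + r)))))) (p + 2 * r) :=
      (((hyd _ (hmem (p + 2 * r + r) (by linarith) (by linarith))).comp_add_const
        (p + 2 * r) r).const_sub _).const_mul _
    have h2 : HasDerivAt (fun b => C * Real.exp (k * p) * (y (p + r) - y b))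
        (C * Real.exp (k * p) * -(-(D * Real.exp (-(l * (p + 2 * r)))))) (p + 2 * r) :=
      ((hyd _ (hmem (p + 2 * r) (by linarith) (by linarith))).const_sub _).const_mul _
    have hev : (fun b => C * Real.exp (k * p) * (y (p + r) - y b)) =ᶠ[𝓝 (p + 2 * r)]
        (fun b => C * Real.exp (k * (p + r)) * (y (p + r + r) - y (b + r))) := by
      filter_upwards [Ioo_mem_nhds (by linarith : p + r < p + 2 * r)
        (by linarith : p + 2 * r < p + 3 * r)] with b hb
      have hprI := hmem (p + r) (by linarith) (by linarith)
      have := h.deriv_shift hy (r := r) hp hprI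
        (by linarith : p < p + r) hb.1 (hmem b (by linarith [hb.1]) (by linarith [hb.2]))
        (hmem (b + r) (by linarith [hb.1]) (by linarith [hb.2]))
      rw [(hxd p hp).deriv, (hxd _ hprI).deriv] at this
      exact this.symm
    have := (h1.congr_of_eventuallyEq hev).unique h2
    linarith
  have hkl : l = k := by
    have e1 : k * (p + r) + -(l * (p + 2 * r + r)) = k * p + -(l * (p + 2 * r)) := by
      apply Real.exp_injective
      rw [Real.exp_add, Real.exp_add]
      have : (C * D) * (Real.exp (k * (p + r)) * Real.exp (-(l * (p + 2 * r + r)))) =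
        (C * D) * (Real.exp (k * p) * Real.exp (-(l * (p + 2 * r)))) := by linarith
      exact mul_left_cancel₀ (mul_pos hC hD).ne' this
    have : r * (l - k) = 0 := by linarith
    linarith [(mul_eq_zero.1 this).resolve_left hr0.ne']
  subst hkl
  exact ⟨C, D, l, hC, hD, hxd, hyd⟩

theorem eq_exp_of_hasDerivAt {I : Set ℝ} (hI : IsOpen I) (hc : I.OrdConnected) {f : ℝ → ℝ}
    {C k : ℝ} (hk : k ≠ 0) (h : ∀ t ∈ I, HasDerivAt f (C * Real.exp (k * t)) t) :
    ∃ a, ∀ t ∈ I, f t = a + C / k * Real.exp (k * t) := by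
  have hd : ∀ t ∈ I, HasDerivAt (fun t => f t - C / k * Real.exp (k * t)) 0 t := fun t ht => by
    have h1 := (((hasDerivAt_id' t).const_mul k).exp).const_mul (C / k)
    exact ((h t ht).sub h1).congr_deriv (by field_simp; ring)
  obtain ⟨a, ha⟩ := hI.exists_is_const_of_deriv_eq_zero hc.isPreconnected
    (fun t ht => (hd t ht).differentiableAt.differentiableWithinAt)
    (fun t ht => (hd t ht).deriv)
  exact ⟨a, fun t ht => by linarith [ha t ht]⟩

theorem oblique_or_hyperbolic (h : IsStationaryPath I x y)
    (hx : StrictMonoOn x I) (hy : StrictAntiOn y I) :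
    (∃ a b c d : ℝ, 0 < b ∧ 0 < d ∧ ∀ t ∈ I, x t = a + b * t ∧ y t = c - d * t) ∨
    (∃ a b c : ℝ, 0 < a ∧ 0 < b ∧ 0 < c ∧
      ∀ t ∈ I, x t = a * Real.exp (c * t) ∧ y t = b * Real.exp (-(c * t))) := by
  obtain ⟨C, D, k, hC, hD, hxd, hyd⟩ := h.exists_common_rate hx hy
  by_cases hk : k = 0
  · left
    subst hk
    simp only [zero_mul, neg_zero, Real.exp_zero, mul_one] at hxd hyd
    obtain ⟨a, ha⟩ := eq_affine_of_hasDerivAt h.isOpen h.ordConnected hxd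
    obtain ⟨c, hc⟩ := eq_affine_of_hasDerivAt h.isOpen h.ordConnected hyd
    exact ⟨a, C, c, D, hC, hD, fun t ht => ⟨ha t ht, by linarith [hc t ht]⟩⟩
  right
  obtain ⟨a, ha⟩ := eq_exp_of_hasDerivAt h.isOpen h.ordConnected hk hxd
  obtain ⟨c, hc⟩ := eq_exp_of_hasDerivAt h.isOpen h.ordConnected (f := y) (C := -D) (k := -k)
    (neg_ne_zero.2 hk) (fun t ht => by
      have := hyd t ht
      rwa [← neg_mul, ← neg_mul] at this)
  rw [neg_div_neg_eq] at hc
  set p := C / k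
  set q := D / k
  have hp : p ≠ 0 := div_ne_zero hC.ne' hk
  have hq : q ≠ 0 := div_ne_zero hD.ne' hk
  obtain ⟨u, hu, w, hw, huw⟩ := h.exists_lt
  set r := (w - u) / 3 with hr
  have hr0 : 0 < r := by rw [hr]; linarith
  have hmem : ∀ c, u ≤ c → c ≤ w → c ∈ I := fun c h1 h2 => h.ordConnected.out hu hw ⟨h1, h2⟩
  set E := Real.exp (k * u) with hE
  set R := Real.exp (k * r) with hR
  have hE0 : 0 < E := Real.exp_pos _
  have hR0 : 0 < R := Real.exp_pos _
  have hR1 : R ≠ 1 := by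
    rw [hR, Ne, Real.exp_eq_one_iff]
    exact mul_ne_zero hk hr0.ne'
  have hxn : ∀ n : ℕ, u + n * r ∈ I → x (u + n * r) = a + p * (E * R ^ n) := fun n hn => by
    rw [ha _ hn, hE, hR, ← Real.exp_nat_mul, ← Real.exp_add]
    ring_nf
  have hyn : ∀ n : ℕ, u + n * r ∈ I → y (u + n * r) = c + q * (E * R ^ n)⁻¹ := fun n hn => by
    rw [hc _ hn, hE, hR, ← Real.exp_nat_mul, ← Real.exp_add, ← Real.exp_neg]
    ring_nf
  have m : ∀ n : ℕ, n ≤ 3 → u + n * r ∈ I := fun n hn => by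
    have h3 : (n : ℝ) ≤ 3 := by exact_mod_cast hn
    have h0 : (0 : ℝ) ≤ n := n.cast_nonneg
    refine hmem _ (by nlinarith) ?_
    have : (n : ℝ) * r ≤ 3 * r := by gcongr
    linarith
  -- Three consecutive steps of length `r` sweep equal areas. The two resulting equations force `c =
  -- 0` and then `a = 0`.
  have hstat : ∀ n : ℕ, n ≤ 2 → sweptArea x y (u + n * r) (u + (n + 1 : ℕ) * r) =
      sweptArea x y (u + (0 : ℕ) * r) (u + (1 : ℕ) * r) := by
    intro n hn
    have := h.stat (u + (0 : ℕ) * r) (u + (1 : ℕ) * r) (n * r) (m 0 (by norm_num))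
      (m 1 (by norm_num)) (by simpa using m n (by omega))
      (by convert m (n + 1) (by omega) using 1; push_cast; ring) (by push_cast; linarith)
    rw [← this]
    congr 1 <;> push_cast <;> ring
  have s1 := hstat 1 (by norm_num)
  have s2 := hstat 2 (by norm_num)
  simp only [sweptArea] at s1 s2
  rw [hxn 0 (m 0 (by norm_num)), hyn 0 (m 0 (by norm_num)), hxn 1 (m 1 (by norm_num)),
    hyn 1 (m 1 (by norm_num)), hxn (1 + 1) (m 2 (by norm_num)),
    hyn (1 + 1) (m 2 (by norm_num))] at s1
  rw [hxn 0 (m 0 (by norm_num)), hyn 0 (m 0 (by norm_num)), hxn 1 (m 1 (by norm_num)),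
    hyn 1 (m 1 (by norm_num)), hxn 2 (m 2 (by norm_num)), hyn 2 (m 2 (by norm_num)),
    hxn (2 + 1) (m 3 (by norm_num)), hyn (2 + 1) (m 3 (by norm_num))] at s2
  have t1 : (R - 1) ^ 2 * (c * p * E ^ 2 * R ^ 2 - a * q) = 0 := by
    field_simp at s1
    refine mul_left_cancel₀ hR0.ne' ?_
    linear_combination s1
  have t2 : (R - 1) ^ 2 * (R + 1) * (c * p * E ^ 2 * R ^ 3 - a * q) = 0 := by
    field_simp at s2
    refine mul_left_cancel₀ (pow_pos hR0 2).ne' ?_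
    linear_combination s2
  have hR1' : R - 1 ≠ 0 := sub_ne_zero.2 hR1
  have u1 := (mul_eq_zero.1 t1).resolve_left (by positivity)
  have u2 := (mul_eq_zero.1 t2).resolve_left (by positivity)
  have v1 : c * p * E ^ 2 * R ^ 2 * (R - 1) = 0 := by linear_combination u2 - u1
  have hc0 : c = 0 := by
    simpa [hp, hE0.ne', hR0.ne', hR1'] using v1
  have ha0 : a = 0 := by
    rw [hc0] at u1
    simpa [hq] using u1
  subst hc0 ha0
  simp only [zero_add] at ha hc
  -- With `a = 0`, positivity of `x` fixes the sign of `C / k`.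
  have hk0 : 0 < k := by
    have := h.pos_x u hu
    rw [ha u hu] at this
    have h1 : 0 < C / k := (mul_pos_iff_of_pos_right (Real.exp_pos _)).1 this
    exact (div_pos_iff_of_pos_left hC).1 h1
  exact ⟨p, q, k, div_pos hC hk0, div_pos hD hk0, hk0, fun t ht => ⟨ha t ht, by
    rw [hc t ht, neg_mul]⟩⟩

/-- Classification of the decreasing paths with stationary swept area. -/
theorem classification (h : IsStationaryPath I x y) :
    (∃ a b c : ℝ, 0 < a ∧ 0 < c ∧ ∀ t ∈ I, x t = a ∧ y t = b - c * t) ∨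
    (∃ a b c : ℝ, 0 < a ∧ 0 < c ∧ ∀ t ∈ I, x t = b + c * t ∧ y t = a) ∨
    (∃ σ ∈ I, ∃ a b c d : ℝ, 0 < a ∧ 0 < b ∧ 0 < c ∧ 0 < d ∧ a * c = b * d ∧
      ∀ t ∈ I, x t = a + d * max (t - σ) 0 ∧ y t = b - c * min (t - σ) 0) ∨
    (∃ a b c d : ℝ, 0 < b ∧ 0 < d ∧ ∀ t ∈ I, x t = a + b * t ∧ y t = c - d * t) ∨
    (∃ a b c : ℝ, 0 < a ∧ 0 < b ∧ 0 < c ∧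
      ∀ t ∈ I, x t = a * Real.exp (c * t) ∧ y t = b * Real.exp (-(c * t))) := by
  by_cases hx : ∀ s ∈ I, ∀ t ∈ I, x s = x t
  · exact Or.inl (h.vertical_of_x_const hx)
  by_cases hy : ∀ s ∈ I, ∀ t ∈ I, y s = y t
  · right; left
    obtain ⟨a, b, c, ha, hc, hab⟩ := h.reverse.vertical_of_x_const
      (fun s hs t ht => hy (-s) hs (-t) ht)
    refine ⟨a, b, c, ha, hc, fun t ht => ?_⟩
    have := hab (-t) (by simpa using ht)
    simp only [neg_neg] at this
    exact ⟨by linarith [this.2], this.1⟩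
  by_cases hsx : StrictMonoOn x I
  · by_cases hsy : StrictAntiOn y I
    · exact Or.inr (Or.inr (Or.inr (h.oblique_or_hyperbolic hsx hsy)))
    · right; right; left
      obtain ⟨p, hp, q, hq, hpq, hle⟩ : ∃ p ∈ I, ∃ q ∈ I, p < q ∧ y p ≤ y q := by
        by_contra! hcon
        exact hsy fun s hs t ht hst => hcon s hs t ht hst
      have he : y q = y p := le_antisymm (h.anti hp hq hpq.le) hle
      refine h.turning (fun a s t b ha hb has hst htb =>
        h.degenerate_of_locally_degenerate (sub_pos.2 hpq) (fun a s b ha hb has hsb hab => ?_)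
          ha hb has hst htb) hx hy
      have := h.reverse.locally_degenerate (p := -q) (q := -p) (by simpa using hq)
        (by simpa using hp) (by simpa using he) (a := -b) (s := -s) (b := -a)
        (by simpa using hb) (by simpa using ha) (neg_lt_neg hsb) (neg_lt_neg has) (by linarith)
      simp only [neg_neg] at this
      exact this.symm.imp Eq.symm Eq.symm
  · right; right; left
    obtain ⟨p, hp, q, hq, hpq, hle⟩ : ∃ p ∈ I, ∃ q ∈ I, p < q ∧ x q ≤ x p := by
      by_contra! hcon
      exact hsx fun s hs t ht hst => hcon s hs t ht hst
    have he : x p = x q := le_antisymm (h.mono hp hq hpq.le) hle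
    exact h.turning (fun a s t b ha hb has hst htb =>
      h.degenerate_of_locally_degenerate (sub_pos.2 hpq) (fun a s b ha hb has hsb hab =>
        h.locally_degenerate hp hq he ha hb has hsb hab) ha hb has hst htb) hx hy

end IsStationaryPath
-- Distinguished logarithms.
-- Uniqueness of lifts through the covering map `Complex.exp`.
theorem eq_of_exp_eq {A : Type*} [TopologicalSpace A] [PreconnectedSpace A] {f g : A → ℂ}
    (hf : Continuous f) (hg : Continuous g) (a : A) (ha : f a = g a)
    (h : ∀ z, Complex.exp (f z) = Complex.exp (g z)) : f = g :=
  Complex.isCoveringMap_exp.eq_of_comp_eq hf hg (by ext z; exact h z) a ha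

theorem eq_one_of_pow_eq_one {A : Type*} [TopologicalSpace A] [PreconnectedSpace A] {f : A → ℂ}
    (hf : Continuous f) (a : A) (ha : f a = 1) {n : ℕ} (hn : 0 < n) (h : ∀ z, f z ^ n = 1) (z : A) :
    f z = 1 := by
  have hfin : {w : ℂ | w ^ n = 1}.Finite := by
    refine (Polynomial.nthRoots n (1 : ℂ)).toFinset.finite_toSet.subset fun w hw => ?_
    simpa [Polynomial.mem_nthRoots hn] using hw
  rw [isPreconnected_univ.constant_of_mapsTo hfin.isDiscrete hf.continuousOn
    (fun z _ => h z) (Set.mem_univ z) (Set.mem_univ a), ha]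

/-- A continuous multiplicative semigroup of continuous functions is determined by the
distinguished logarithm of its value at time one. -/
theorem eq_exp_of_semigroup {A : Type*} [TopologicalSpace A] [PreconnectedSpace A]
    {G : ℝ≥0 → A → ℂ} {ψ : A → ℂ} (a : A) (hψ : Continuous ψ) (hψ0 : ψ a = 0)
    (h1 : ∀ z, G 1 z = Complex.exp (ψ z)) (hadd : ∀ s t z, G (s + t) z = G s z * G t z)
    (hGc : ∀ t, Continuous (G t)) (hGa : ∀ t, G t a = 1) (hct : ∀ z, Continuous fun t => G t z)
    (t : ℝ≥0) (z : A) : G t z = Complex.exp ((t : ℂ) * ψ z) := by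
  have hG0 : ∀ z, G 0 z = 1 := fun z => by
    have := hadd 0 1 z
    rw [zero_add] at this
    have hne : G 1 z ≠ 0 := by rw [h1]; exact Complex.exp_ne_zero _
    exact (mul_right_cancel₀ hne (by rw [one_mul]; exact this)).symm
  have hpow : ∀ (n : ℕ) s z, G (n * s) z = G s z ^ n := by
    intro n s z
    induction n with
    | zero => simp [hG0]
    | succ n ih => rw [Nat.cast_succ, add_mul, one_mul, hadd, ih, pow_succ]
  have hinv : ∀ n : ℕ, 0 < n → ∀ z, G (n : ℝ≥0)⁻¹ z = Complex.exp ((n : ℂ)⁻¹ * ψ z) := by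
    intro n hn z
    have hn0 : (n : ℝ≥0) ≠ 0 := by positivity
    have hn0' : (n : ℂ) ≠ 0 := by exact_mod_cast hn.ne'
    -- The quotient of `G (1 / n)` by `exp (ψ / n)` is a continuous function with values in the
    -- `n`-th roots of unity, equal to one at `a`.
    have key := eq_one_of_pow_eq_one (f := fun z => G (n : ℝ≥0)⁻¹ z *
      Complex.exp (-((n : ℂ)⁻¹ * ψ z))) (by have := hGc (n : ℝ≥0)⁻¹; fun_prop) a
      (by simp [hGa, hψ0]) hn (fun z => by
        rw [mul_pow, ← hpow, mul_inv_cancel₀ hn0, h1, ← Complex.exp_nat_mul, ← Complex.exp_add,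
          mul_neg, mul_inv_cancel_left₀ hn0', add_neg_cancel, Complex.exp_zero]) z
    rw [Complex.exp_neg] at key
    exact (mul_inv_eq_one₀ (Complex.exp_ne_zero _)).1 key
  have hrat : ∀ m n : ℕ, 0 < n →
      G ((m : ℝ≥0) / n) z = Complex.exp ((((m : ℝ≥0) / n : ℝ≥0) : ℂ) * ψ z) := by
    intro m n hn
    rw [div_eq_mul_inv, hpow, hinv n hn, ← Complex.exp_nat_mul]
    congr 1
    push_cast
    ring
  have hlim : Tendsto (fun n : ℕ => ((⌊(t : ℝ) * n⌋₊ : ℝ≥0) / n)) atTop (𝓝 t) := by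
    rw [← NNReal.tendsto_coe]
    have := (tendsto_nat_floor_mul_div_atTop (R := ℝ) t.2).comp tendsto_natCast_atTop_atTop
    simpa [Function.comp_def] using this
  have hR : Continuous fun t : ℝ≥0 => Complex.exp ((t : ℂ) * ψ z) := by
    have : Continuous fun t : ℝ≥0 => ((t : ℝ) : ℂ) :=
      Complex.continuous_ofReal.comp NNReal.continuous_coe
    exact Complex.continuous_exp.comp (this.mul continuous_const)
  refine tendsto_nhds_unique_of_eventuallyEq (((hct z).tendsto t).comp hlim)
    ((hR.tendsto t).comp hlim) ?_
  filter_upwards [eventually_gt_atTop 0] with n hn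
  exact hrat _ n hn

/-! ### Characteristic functions of measures. -/

section Measures

variable {E : Type*} [NormedAddCommGroup E] [InnerProductSpace ℝ E] [MeasurableSpace E]
  [BorelSpace E] [SecondCountableTopology E]

theorem charFun_map_neg {Ω : Type*} [MeasurableSpace Ω] {P : Measure Ω} {Y : Ω → E}
    (hY : AEMeasurable Y P) (z : E) :
    charFun (P.map fun ω => -Y ω) z = charFun (P.map Y) (-z) := by
  rw [charFun_apply, charFun_apply, integral_map (φ := fun ω => -Y ω) hY.neg (by fun_prop),
    integral_map hY (by fun_prop)]
  simp

/-- A probability measure whose characteristic function has constant modulus one is a Dirac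
measure. -/
theorem exists_eq_dirac_of_norm_charFun_eq_one [CompleteSpace E] (μ : Measure E)
    [IsProbabilityMeasure μ] (h : ∀ z, ‖charFun μ z‖ = 1) : ∃ c, μ = Measure.dirac c := by
  -- Symmetrization: the difference of two independent copies has characteristic function `|charFun
  -- μ|² = 1`, so the copies agree almost surely.
  have hsub : (μ.prod μ).map (fun p : E × E => p.1 + -p.2) = Measure.dirac 0 := by
    refine Measure.ext_of_charFun (funext fun z => ?_)
    have hind : IndepFun (fun p : E × E => p.1) (fun p : E × E => -p.2) (μ.prod μ) :=
      (indepFun_prod measurable_id measurable_neg)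
    rw [hind.charFun_map_fun_add_eq_mul (by fun_prop) (by fun_prop), Pi.mul_apply,
      charFun_map_neg (by fun_prop), charFun_neg, charFun_dirac]
    have h1 : (μ.prod μ).map (fun p : E × E => p.1) = μ := measurePreserving_fst.map_eq
    have h2 : (μ.prod μ).map (fun p : E × E => p.2) = μ := measurePreserving_snd.map_eq
    rw [h1, h2, Complex.mul_conj, Complex.normSq_eq_norm_sq, h z]
    simp
  have hae : ∀ᵐ p ∂(μ.prod μ), p.1 + -p.2 = 0 := by
    have : ∀ᵐ q ∂((μ.prod μ).map (fun p : E × E => p.1 + -p.2)), q = 0 := by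
      rw [hsub]
      exact (ae_dirac_iff (measurableSet_singleton 0)).2 rfl
    exact ae_of_ae_map (by fun_prop) this
  obtain ⟨c, hc⟩ := (Measure.ae_ae_of_ae_prod hae).exists
  refine ⟨c, ?_⟩
  have hid : (id : E → E) =ᵐ[μ] fun _ => c := hc.mono fun q hq => by
    simpa using (eq_of_sub_eq_zero (by rwa [sub_eq_add_neg])).symm
  calc μ = μ.map id := Measure.map_id.symm
    _ = μ.map fun _ => c := Measure.map_congr hid
    _ = Measure.dirac c := by simp [Measure.map_const]

end Measures

/-! ### The characteristic function of the sheet. -/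

section Sheets

variable {Ω : Type*} [MeasurableSpace Ω] {d : ℕ} {P : Measure Ω}
  {X : Quarter → Ω → EuclideanSpace ℝ (Fin d)} {ψ : EuclideanSpace ℝ (Fin d) → ℂ}

theorem IsTPLP.measurable_increment (hX : IsTPLP P X) (s t : Quarter) :
    Measurable (increment X s t) := by
  have := hX.measurable
  unfold increment
  fun_prop

theorem IsTPLP.indep_pair (hX : IsTPLP P X) {s t s' t' : Quarter} (hst : s ≤ t) (hst' : s' ≤ t')
    (hd : Disjoint (rect s t) (rect s' t')) :
    IndepFun (increment X s t) (increment X s' t') P := by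
  have := hX.indep 2 ![s, s'] ![t, t'] (by simp [Fin.forall_fin_two, hst, hst']) (by
    intro i j hij
    fin_cases i <;> fin_cases j <;> simp_all [hd.symm])
  simpa using this.indepFun (show (0 : Fin 2) ≠ 1 by decide)

theorem IsTPLP.increment_zero (hX : IsTPLP P X) (t : Quarter) :
    increment X 0 t =ᵐ[P] X t := by
  filter_upwards [hX.axes] with ω hω
  simp [increment, (hω _).1, (hω _).2, Prod.zero_eq_mk]

theorem exponent_neg (hψ : IsExponent P X ψ) (z : EuclideanSpace ℝ (Fin d)) :
    ψ (-z) = (starRingEnd ℂ) (ψ z) := by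
  refine congrFun (eq_of_exp_eq (f := fun z => ψ (-z)) (g := fun z => (starRingEnd ℂ) (ψ z))
    (hψ.continuous.comp continuous_neg) (Complex.continuous_conj.comp hψ.continuous) 0
    (by simp [hψ.map_zero]) fun z => ?_) z
  rw [← hψ.charFun_eq, charFun_neg, hψ.charFun_eq, Complex.exp_conj]

theorem IsTPLP.identDistrib_increment (hX : IsTPLP P X) (s u : Quarter) :
    IdentDistrib (increment X s (s + u)) (X u) P P := by
  have h1 := hX.stationary 0 u s zero_le
  rw [zero_add, add_comm u s] at h1
  exact h1.symm.trans
    (IdentDistrib.of_ae_eq (hX.measurable_increment _ _).aemeasurable (hX.increment_zero u))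

theorem charFun_increment (hX : IsTPLP P X) (s u : Quarter) :
    charFun (P.map (increment X s (s + u))) = charFun (P.map (X u)) := by
  rw [(hX.identDistrib_increment s u).map_eq]

theorem exponent_even_of_isSymmetric (hX : IsTPLP P X) (hψ : IsExponent P X ψ)
    (hs : IsSymmetric P X) (z : EuclideanSpace ℝ (Fin d)) : ψ (-z) = ψ z := by
  refine congrFun (eq_of_exp_eq (f := fun z => ψ (-z)) (hψ.continuous.comp continuous_neg)
    hψ.continuous 0 (by simp) fun z => ?_) z
  have h : IdentDistrib (X (1, 1)) (fun ω => -X (1, 1) ω) P P :=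
    hs.comp (measurable_pi_apply (1, 1))
  rw [← hψ.charFun_eq, ← hψ.charFun_eq, ← charFun_map_neg (hX.measurable _).aemeasurable,
    ← h.map_eq]

variable [IsProbabilityMeasure P]

theorem continuous_charFun_sheet (hX : IsTPLP P X) (z : EuclideanSpace ℝ (Fin d)) :
    Continuous fun t => charFun (P.map (X t)) z := by
  refine continuous_iff_continuousAt.2 fun t => ?_
  have h := ((hX.continuous_prob t).tendstoInDistribution
    (fun s => (hX.measurable s).aemeasurable)).tendsto
  have := (ProbabilityMeasure.tendsto_iff_forall_integral_rclike_tendsto ℂ).1 h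
    (BoundedContinuousFunction.innerProbChar z)
  unfold ContinuousAt
  simp_rw [charFun_eq_integral_innerProbChar]
  exact this

theorem charFun_add_fst (hX : IsTPLP P X) (u u' v : ℝ≥0) (z : EuclideanSpace ℝ (Fin d)) :
    charFun (P.map (X (u + u', v))) z =
      charFun (P.map (X (u, v))) z * charFun (P.map (X (u', v))) z := by
  have hae : X (u + u', v) =ᵐ[P]
      fun ω => increment X 0 (0 + (u, v)) ω + increment X (u, 0) ((u, 0) + (u', v)) ω := by
    filter_upwards [hX.axes] with ω hω
    simp [increment, (hω _).1, (hω _).2, Prod.zero_eq_mk]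
  have hind : IndepFun (increment X 0 (0 + (u, v))) (increment X (u, 0) ((u, 0) + (u', v))) P := by
    refine hX.indep_pair (by simp) (by simp) ?_
    refine Set.disjoint_left.2 fun p hp hp' => ?_
    have h1 := hp.1.2
    have h2 := hp'.1.1
    simp at h1 h2
    exact h2.not_ge h1
  rw [Measure.map_congr hae, hind.charFun_map_fun_add_eq_mul
    (hX.measurable_increment _ _).aemeasurable (hX.measurable_increment _ _).aemeasurable,
    Pi.mul_apply, charFun_increment hX, charFun_increment hX]

theorem charFun_add_snd (hX : IsTPLP P X) (u v v' : ℝ≥0) (z : EuclideanSpace ℝ (Fin d)) :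
    charFun (P.map (X (u, v + v'))) z =
      charFun (P.map (X (u, v))) z * charFun (P.map (X (u, v'))) z := by
  have hae : X (u, v + v') =ᵐ[P]
      fun ω => increment X 0 (0 + (u, v)) ω + increment X (0, v) ((0, v) + (u, v')) ω := by
    filter_upwards [hX.axes] with ω hω
    simp [increment, (hω _).1, (hω _).2, Prod.zero_eq_mk]
  have hind : IndepFun (increment X 0 (0 + (u, v))) (increment X (0, v) ((0, v) + (u, v'))) P := by
    refine hX.indep_pair (by simp) (by simp) ?_
    refine Set.disjoint_left.2 fun p hp hp' => ?_
    have h1 := hp.2.2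
    have h2 := hp'.2.1
    simp at h1 h2
    exact h2.not_ge h1
  rw [Measure.map_congr hae, hind.charFun_map_fun_add_eq_mul
    (hX.measurable_increment _ _).aemeasurable (hX.measurable_increment _ _).aemeasurable,
    Pi.mul_apply, charFun_increment hX, charFun_increment hX]

/-- Two applications of `eq_exp_of_semigroup`: in the first coordinate at height one, then in the
second coordinate at fixed width. -/
theorem charFun_sheet (hX : IsTPLP P X) (hψ : IsExponent P X ψ) (u v : ℝ≥0)
    (z : EuclideanSpace ℝ (Fin d)) :
    charFun (P.map (X (u, v))) z = Complex.exp ((u : ℂ) * v * ψ z) := by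
  have hprob : ∀ t, IsProbabilityMeasure (P.map (X t)) := fun t =>
    Measure.isProbabilityMeasure_map (hX.measurable t).aemeasurable
  have hc : ∀ t, Continuous (charFun (P.map (X t))) := fun t => by
    have := hprob t
    exact continuous_charFun
  have h0 : ∀ t, charFun (P.map (X t)) 0 = 1 := fun t => by
    have := hprob t
    simp
  have hu : ∀ (u : ℝ≥0) z, charFun (P.map (X (u, 1))) z = Complex.exp ((u : ℂ) * ψ z) :=
    eq_exp_of_semigroup (G := fun u => charFun (P.map (X (u, 1)))) 0 hψ.continuous hψ.map_zero
      hψ.charFun_eq (fun s t z => charFun_add_fst hX s t 1 z) (fun _ => hc _) (fun _ => h0 _)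
      (fun z => (continuous_charFun_sheet hX z).comp (by fun_prop))
  have := eq_exp_of_semigroup (G := fun v => charFun (P.map (X (u, v)))) (ψ := fun z => u * ψ z) 0
      (continuous_const.mul hψ.continuous) (by simp [hψ.map_zero])
      (hu u) (fun s t z => charFun_add_snd hX u s t z) (fun _ => hc _) (fun _ => h0 _)
      (fun z => (continuous_charFun_sheet hX z).comp (by fun_prop)) v z
  rw [this]
  congr 1
  ring

/-- The characteristic function of the increment of the sheet between two points, the second of
which lies to the lower right of the first. -/
theorem charFun_along (hX : IsTPLP P X) (hψ : IsExponent P X ψ) {p q : Quarter}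
    (h1 : p.1 ≤ q.1) (h2 : q.2 ≤ p.2) (z : EuclideanSpace ℝ (Fin d)) :
    charFun (P.map fun ω => X q ω - X p ω) z =
      Complex.exp ((((q.1 : ℝ) - p.1) * q.2 : ℝ) * ψ z +
        ((p.1 : ℝ) * (p.2 - q.2) : ℝ) * ψ (-z)) := by
  obtain ⟨x, y'⟩ := p
  obtain ⟨x', y⟩ := q
  dsimp only at h1 h2 ⊢
  obtain ⟨u, rfl⟩ := exists_add_of_le h1
  obtain ⟨v, rfl⟩ := exists_add_of_le h2
  -- The common rectangle `(0, x] × (0, y]` cancels, leaving a right-hand rectangle minus an upper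
  -- one.
  have hae : (fun ω => X (x + u, y) ω - X (x, y + v) ω) =ᵐ[P]
      fun ω => increment X (x, 0) ((x, 0) + (u, y)) ω +
        -increment X (0, y) ((0, y) + (x, v)) ω := by
    filter_upwards [hX.axes] with ω hω
    simp [increment, (hω _).1, (hω _).2]
  have hind : IndepFun (increment X (x, 0) ((x, 0) + (u, y)))
      (increment X (0, y) ((0, y) + (x, v))) P := by
    refine hX.indep_pair (by simp) (by simp) ?_
    refine Set.disjoint_left.2 fun p hp hp' => ?_
    have h1 := hp.1.1
    have h2 := hp'.1.2
    simp at h1 h2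
    exact h1.not_ge h2
  have hind' : IndepFun (increment X (x, 0) ((x, 0) + (u, y)))
      (fun ω => -increment X (0, y) ((0, y) + (x, v)) ω) P := hind.neg_right
  have hm' : AEMeasurable (fun ω => -increment X (0, y) ((0, y) + (x, v)) ω) P :=
    (hX.measurable_increment _ _).neg.aemeasurable
  rw [Measure.map_congr hae, hind'.charFun_map_fun_add_eq_mul
    (hX.measurable_increment _ _).aemeasurable hm',
    Pi.mul_apply]
  rw [charFun_map_neg (hX.measurable_increment _ _).aemeasurable, charFun_increment hX,
    charFun_increment hX, charFun_sheet hX hψ, charFun_sheet hX hψ, ← Complex.exp_add]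
  congr 1
  push_cast
  ring

theorem exists_re_exponent_ne_zero (hX : IsTPLP P X) (hψ : IsExponent P X ψ)
    (hnd : ¬ IsDeterministicSheet P X) : ∃ z, (ψ z).re ≠ 0 := by
  by_contra! h
  have := Measure.isProbabilityMeasure_map (μ := P) (hX.measurable (1, 1)).aemeasurable
  refine hnd ⟨(1, 1), one_pos, one_pos, exists_eq_dirac_of_norm_charFun_eq_one _ fun z => ?_⟩
  rw [hψ.charFun_eq, Complex.norm_exp, h z, Real.exp_zero]

end Sheets

/-! ### An even exponent makes the whole sheet symmetric. -/

/-- Supplies the grid lines through finitely many points. Repeated values are harmless, since they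
only produce empty cells. -/
theorem exists_monotone_enumeration (A : Finset ℝ≥0) :
    ∃ (u : ℕ → ℝ≥0) (N : ℕ), Monotone u ∧ u 0 = 0 ∧ (∀ k, u k = 0 ∨ u k ∈ A) ∧
      ∀ a ∈ A, ∃ k ≤ N, u k = a := by
  induction A using Finset.induction_on_max with
  | empty => exact ⟨fun _ => 0, 0, monotone_const, rfl, fun _ => Or.inl rfl, by simp⟩
  | insert a A ha ih =>
    obtain ⟨u, N, hu, hu0, huA, hex⟩ := ih
    have hle : ∀ k, u k ≤ a := fun k => by
      rcases huA k with h | h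
      · rw [h]; exact zero_le
      · exact (ha _ h).le
    refine ⟨fun k => if k ≤ N then u k else a, N + 1, ?_, by simp [hu0], ?_, ?_⟩
    · intro i j hij
      dsimp only
      split_ifs with h1 h2 h2
      · exact hu hij
      · exact hle i
      · omega
      · rfl
    · intro k
      dsimp only
      split_ifs
      · exact (huA k).imp_right (Finset.mem_insert_of_mem)
      · exact Or.inr (Finset.mem_insert_self _ _)
    · intro b hb
      rcases Finset.mem_insert.1 hb with rfl | hb
      · exact ⟨N + 1, le_rfl, by simp⟩
      · obtain ⟨k, hk, rfl⟩ := hex b hb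
        exact ⟨k, by omega, by simp [hk]⟩

theorem sum_increment_grid {Ω : Type*} {d : ℕ} (X : Quarter → Ω → EuclideanSpace ℝ (Fin d))
    (u v : ℕ → ℝ≥0) (m n : ℕ) (ω : Ω) :
    ∑ i ∈ Finset.range m, ∑ j ∈ Finset.range n,
      increment X (u i, v j) (u (i + 1), v (j + 1)) ω =
    increment X (u 0, v 0) (u m, v n) ω := by
  have h1 : ∀ i, ∑ j ∈ Finset.range n, increment X (u i, v j) (u (i + 1), v (j + 1)) ω =
      (X (u (i + 1), v n) ω - X (u (i + 1), v 0) ω) - (X (u i, v n) ω - X (u i, v 0) ω) := by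
    intro i
    rw [← Finset.sum_range_sub (fun j => X (u (i + 1), v j) ω),
      ← Finset.sum_range_sub (fun j => X (u i, v j) ω), ← Finset.sum_sub_distrib]
    refine Finset.sum_congr rfl fun j _ => ?_
    simp only [increment]
    abel
  simp_rw [h1]
  rw [Finset.sum_range_sub (fun i => X (u i, v n) ω - X (u i, v 0) ω)]
  simp only [increment]
  abel

section Sheets

variable {Ω : Type*} [MeasurableSpace Ω] {d : ℕ} {P : Measure Ω}
  {X : Quarter → Ω → EuclideanSpace ℝ (Fin d)} {ψ : EuclideanSpace ℝ (Fin d) → ℂ}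

variable [IsProbabilityMeasure P]

theorem identDistrib_neg_increment (hX : IsTPLP P X) (hψ : IsExponent P X ψ)
    (heven : ∀ z, ψ (-z) = ψ z) {s t : Quarter} (hst : s ≤ t) :
    P.map (fun ω => -increment X s t ω) = P.map (increment X s t) := by
  obtain ⟨u, rfl⟩ := exists_add_of_le hst
  have hm := hX.measurable_increment s (s + u)
  have h1 := Measure.isProbabilityMeasure_map (μ := P) hm.aemeasurable
  have h2 := Measure.isProbabilityMeasure_map (μ := P) hm.neg.aemeasurable
  refine Measure.ext_of_charFun (funext fun z => ?_)
  rw [charFun_map_neg hm.aemeasurable, charFun_increment hX, charFun_sheet hX hψ,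
    charFun_sheet hX hψ, heven]

/-- The values of `X` at finitely many points are sums of increments over the cells of a grid. These
increments are independent and individually symmetric, so their joint law is symmetric, and an odd
map (`L`) carries this over to the values of `X`. -/
theorem isSymmetric_of_exponent_even (hX : IsTPLP P X) (hψ : IsExponent P X ψ)
    (heven : ∀ z, ψ (-z) = ψ z) : IsSymmetric P X := by
  have hmX : Measurable fun ω (t : Quarter) => X t ω := measurable_pi_lambda _ hX.measurable
  have hmX' : Measurable fun ω (t : Quarter) => -X t ω :=
    measurable_pi_lambda _ fun t => (hX.measurable t).neg
  refine (identDistrib_iff_forall_finset_identDistrib (X := X) (Y := fun t ω => -X t ω)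
    hmX.aemeasurable hmX'.aemeasurable).2 fun I => ?_
  obtain ⟨u, M, hu, hu0, -, huI⟩ := exists_monotone_enumeration (I.image Prod.fst)
  obtain ⟨v, N, hv, hv0, -, hvI⟩ := exists_monotone_enumeration (I.image Prod.snd)
  have hex : ∀ t : I, ∃ m n : ℕ, m ≤ M ∧ n ≤ N ∧ u m = t.1.1 ∧ v n = t.1.2 := fun t => by
    obtain ⟨m, hm, hm'⟩ := huI t.1.1 (Finset.mem_image_of_mem _ t.2)
    obtain ⟨n, hn, hn'⟩ := hvI t.1.2 (Finset.mem_image_of_mem _ t.2)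
    exact ⟨m, n, hm, hn, hm', hn'⟩
  choose m n hm hn hum hvn using hex
  let e : Fin M × Fin N ≃ Fin (M * N) := finProdFinEquiv
  let S : Fin (M * N) → Quarter := fun k => (u (e.symm k).1, v (e.symm k).2)
  let S' : Fin (M * N) → Quarter := fun k => (u ((e.symm k).1 + 1), v ((e.symm k).2 + 1))
  have hSS' : ∀ k, S k ≤ S' k := fun k => ⟨hu (Nat.le_succ _), hv (Nat.le_succ _)⟩
  have hmR : ∀ k, Measurable (increment X (S k) (S' k)) := fun k => hX.measurable_increment _ _
  have hind : iIndepFun (fun k => increment X (S k) (S' k)) P := by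
    refine hX.indep _ S S' hSS' fun k l hkl => ?_
    have hne : e.symm k ≠ e.symm l := e.symm.injective.ne hkl
    by_cases h1 : (e.symm k).1 = (e.symm l).1
    · have h2 : ((e.symm k).2 : ℕ) ≠ (e.symm l).2 := fun h2 => hne (Prod.ext h1 (Fin.ext h2))
      exact Set.disjoint_prod.2 (Or.inr (hv.pairwise_disjoint_on_Ioc_succ h2))
    · have h2 : ((e.symm k).1 : ℕ) ≠ (e.symm l).1 := fun h2 => h1 (Fin.ext h2)
      exact Set.disjoint_prod.2 (Or.inl (hu.pairwise_disjoint_on_Ioc_succ h2))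
  have hind' : iIndepFun (fun k ω => -increment X (S k) (S' k) ω) P :=
    hind.comp (fun _ w => -w) fun _ => measurable_neg
  have hmR' : ∀ k, AEMeasurable (fun ω => -increment X (S k) (S' k) ω) P :=
    fun k => (hmR k).neg.aemeasurable
  have hV : IdentDistrib (fun ω k => increment X (S k) (S' k) ω)
      (fun ω k => -increment X (S k) (S' k) ω) P P := by
    refine ⟨(measurable_pi_lambda _ hmR).aemeasurable,
      (measurable_pi_lambda _ fun k => (hmR k).neg).aemeasurable, ?_⟩
    rw [(iIndepFun_iff_map_fun_eq_pi_map fun k => (hmR k).aemeasurable).1 hind,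
      (iIndepFun_iff_map_fun_eq_pi_map hmR').1 hind']
    congr 1
    funext k
    exact (identDistrib_neg_increment hX hψ heven (hSS' k)).symm
  -- The default value `0` is never used, because `m t ≤ M` and `n t ≤ N`.
  let L : (Fin (M * N) → EuclideanSpace ℝ (Fin d)) → I → EuclideanSpace ℝ (Fin d) := fun w t =>
    ∑ i ∈ Finset.range (m t), ∑ j ∈ Finset.range (n t),
      if h : i < M ∧ j < N then w (e (⟨i, h.1⟩, ⟨j, h.2⟩)) else 0
  have hLm : Measurable L := by
    refine measurable_pi_lambda _ fun t => Finset.measurable_fun_sum _ fun i _ =>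
      Finset.measurable_fun_sum _ fun j _ => ?_
    split_ifs
    · exact measurable_pi_apply _
    · exact measurable_const
  have hLneg : ∀ w, L (fun k => -w k) = -L w := by
    intro w
    funext t
    simp only [L, Pi.neg_apply, ← Finset.sum_neg_distrib]
    refine Finset.sum_congr rfl fun i _ => Finset.sum_congr rfl fun j _ => ?_
    split_ifs <;> simp
  have hL : ∀ᵐ ω ∂P, L (fun k => increment X (S k) (S' k) ω) = I.restrict (X · ω) := by
    filter_upwards [hX.axes] with ω hω
    funext t
    have h1 : L (fun k => increment X (S k) (S' k) ω) t =
        increment X (u 0, v 0) (u (m t), v (n t)) ω := by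
      rw [← sum_increment_grid]
      refine Finset.sum_congr rfl fun i hi => Finset.sum_congr rfl fun j hj => ?_
      have hi' := (Finset.mem_range.1 hi).trans_le (hm t)
      have hj' := (Finset.mem_range.1 hj).trans_le (hn t)
      rw [dif_pos ⟨hi', hj'⟩]
      simp [S, S']
    rw [h1, hu0, hv0, hum, hvn]
    simp [increment, (hω _).1, (hω _).2]
  refine (IdentDistrib.of_ae_eq (hLm.comp (measurable_pi_lambda _ hmR)).aemeasurable hL).symm.trans
    ((hV.comp hLm).trans (IdentDistrib.of_ae_eq
      (hLm.comp (measurable_pi_lambda _ fun k => (hmR k).neg)).aemeasurable ?_))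
  filter_upwards [hL] with ω hω
  refine (hLneg fun k => increment X (S k) (S' k) ω).trans ?_
  rw [hω]
  rfl

end Sheets

/-! ### Decreasing paths on `T` and the areas of the four families. -/

section Paths

variable {T : Set ℝ} {x y : ℝ → ℝ≥0}

theorem IsDecreasingPath.nonempty_interior (hα : IsDecreasingPath T x y) :
    (interior T).Nonempty := by
  have key : ∀ s ∈ T, ∀ t ∈ T, s < t → (interior T).Nonempty := fun s hs t ht hst =>
    (Set.nonempty_Ioo.2 hst).mono (interior_maximal
      (Set.Ioo_subset_Icc_self.trans (hα.interval.out hs ht)) isOpen_Ioo)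
  have key' : ∀ s ∈ T, ∀ t ∈ T, s ≠ t → (interior T).Nonempty := fun s hs t ht hst => by
    rcases hst.lt_or_gt with h | h
    · exact key s hs t ht h
    · exact key t ht s hs h
  rcases hα.nonconstant with ⟨s, hs, t, ht, h⟩ | ⟨s, hs, t, ht, h⟩ <;>
  exact key' s hs t ht fun he => h (he ▸ rfl)

theorem IsDecreasingPath.isStationaryPath (hα : IsDecreasingPath T x y)
    (hstat : ∀ s ∈ T, ∀ t ∈ T, ∀ s' ∈ T, ∀ t' ∈ T, s < t → t' - s' = t - s →
      sweptArea (fun t => x t) (fun t => y t) s' t' =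
        sweptArea (fun t => x t) (fun t => y t) s t) :
    IsStationaryPath (interior T) (fun t => x t) (fun t => y t) where
  isOpen := isOpen_interior
  ordConnected := hα.interval.interior
  mono := fun s hs t ht hst =>
    NNReal.coe_le_coe.2 (hα.monotone_x (interior_subset hs) (interior_subset ht) hst)
  anti := fun s hs t ht hst =>
    NNReal.coe_le_coe.2 (hα.antitone_y (interior_subset hs) (interior_subset ht) hst)
  cont_x := NNReal.continuous_coe.comp_continuousOn (hα.continuous_x.mono interior_subset)
  cont_y := NNReal.continuous_coe.comp_continuousOn (hα.continuous_y.mono interior_subset)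
  pos_x := fun t ht => NNReal.coe_pos.2 (hα.pos_x t ht)
  pos_y := fun t ht => NNReal.coe_pos.2 (hα.pos_y t ht)
  stat := fun s t r hs ht hsr htr hst => hstat s (interior_subset hs) t (interior_subset ht)
    (s + r) (interior_subset hsr) (t + r) (interior_subset htr) hst (by ring)
  nonconst := fun hc => by
    obtain ⟨p, hp⟩ := hα.nonempty_interior
    have hx : ∀ t ∈ T, (x t : ℝ) = x p := fun t ht =>
      eqOn_of_eqOn_interior (f := fun t => (x t : ℝ)) (g := fun _ => (x p : ℝ)) hα.interval ⟨p, hp⟩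
        (NNReal.continuous_coe.comp_continuousOn hα.continuous_x) continuousOn_const
        (fun t ht => (hc t ht p hp).1) ht
    have hy : ∀ t ∈ T, (y t : ℝ) = y p := fun t ht =>
      eqOn_of_eqOn_interior (f := fun t => (y t : ℝ)) (g := fun _ => (y p : ℝ)) hα.interval ⟨p, hp⟩
        (NNReal.continuous_coe.comp_continuousOn hα.continuous_y) continuousOn_const
        (fun t ht => (hc t ht p hp).2) ht
    rcases hα.nonconstant with ⟨s, hs, t, ht, h⟩ | ⟨s, hs, t, ht, h⟩
    · exact h (NNReal.coe_injective ((hx s hs).trans (hx t ht).symm))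
    · exact h (NNReal.coe_injective ((hy s hs).trans (hy t ht).symm))

theorem IsDecreasingPath.exists_family (hα : IsDecreasingPath T x y)
    (hstat : ∀ s ∈ T, ∀ t ∈ T, ∀ s' ∈ T, ∀ t' ∈ T, s < t → t' - s' = t - s →
      sweptArea (fun t => x t) (fun t => y t) s' t' =
        sweptArea (fun t => x t) (fun t => y t) s t) :
    (∃ a b c : ℝ, FamilyI T x y a b c) ∨
    (∃ σ a b c d : ℝ, FamilyII T x y σ a b c d) ∨
    (∃ a b c d : ℝ, FamilyIII T x y a b c d) ∨
    (∃ a b c : ℝ, FamilyIV T x y a b c) := by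
  have ext : ∀ f g : ℝ → ℝ, Continuous f → Continuous g →
      (∀ t ∈ interior T, (x t : ℝ) = f t ∧ (y t : ℝ) = g t) →
      ∀ t ∈ T, (x t : ℝ) = f t ∧ (y t : ℝ) = g t := fun f g hf hg h t ht =>
    ⟨eqOn_of_eqOn_interior hα.interval hα.nonempty_interior
      (NNReal.continuous_coe.comp_continuousOn hα.continuous_x) hf.continuousOn
      (fun t ht => (h t ht).1) ht,
    eqOn_of_eqOn_interior hα.interval hα.nonempty_interior
      (NNReal.continuous_coe.comp_continuousOn hα.continuous_y) hg.continuousOn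
      (fun t ht => (h t ht).2) ht⟩
  rcases (hα.isStationaryPath hstat).classification with
    ⟨a, b, c, ha, hc, h⟩ | ⟨a, b, c, ha, hc, h⟩ | ⟨σ, hσ, a, b, c, d, ha, hb, hc, hd, hac, h⟩ |
    ⟨a, b, c, d, hb, hd, h⟩ | ⟨a, b, c, ha, hb, hc, h⟩
  · exact Or.inl ⟨a, b, c, ha, hc, Or.inl (ext _ _ (by fun_prop) (by fun_prop) h)⟩
  · exact Or.inl ⟨a, b, c, ha, hc, Or.inr (ext _ _ (by fun_prop) (by fun_prop) h)⟩
  · refine Or.inr (Or.inl ⟨σ, a, b, c, d, hσ, ha, hb, hc, hd, hac, fun t ht => ?_⟩)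
    obtain ⟨h1, h2⟩ := ext _ _ (by fun_prop) (by fun_prop) h t ht
    rw [h1, h2]
    rcases lt_or_ge σ t with hlt | hge
    · rw [max_eq_left (by linarith), min_eq_right (by linarith), if_pos hlt, if_neg hlt.not_ge]
      simp
    · rw [max_eq_right (by linarith), min_eq_left (by linarith), if_neg hge.not_gt, if_pos hge]
      simp
  · exact Or.inr (Or.inr (Or.inl ⟨a, b, c, d, hb, hd, ext _ _ (by fun_prop) (by fun_prop) h⟩))
  · exact Or.inr (Or.inr (Or.inr ⟨a, b, c, ha, hb, hc, ext _ _ (by fun_prop) (by fun_prop) h⟩))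

theorem FamilyI.areas {a b c : ℝ} (h : FamilyI T x y a b c) :
    (∀ s ∈ T, ∀ t ∈ T, ((x t : ℝ) - x s) * y t = 0 ∧ (x s : ℝ) * (y s - y t) = a * c * (t - s)) ∨
    (∀ s ∈ T, ∀ t ∈ T, ((x t : ℝ) - x s) * y t = a * c * (t - s) ∧
      (x s : ℝ) * (y s - y t) = 0) := by
  obtain ⟨-, -, h | h⟩ := h
  · left
    intro s hs t ht
    rw [(h s hs).1, (h s hs).2, (h t ht).1, (h t ht).2]
    constructor <;> ring
  · right
    intro s hs t ht
    rw [(h s hs).1, (h s hs).2, (h t ht).1, (h t ht).2]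
    constructor <;> ring

theorem FamilyI.sweptArea_eq {a b c : ℝ} (h : FamilyI T x y a b c) {s t : ℝ} (hs : s ∈ T)
    (ht : t ∈ T) : sweptArea (fun t => x t) (fun t => y t) s t = a * c * (t - s) := by
  unfold sweptArea
  rcases h.areas with h | h <;> rw [(h s hs t ht).1, (h s hs t ht).2] <;> ring

theorem FamilyII.sweptArea_eq {σ a b c d : ℝ} (h : FamilyII T x y σ a b c d) {s t : ℝ} (hs : s ∈ T)
    (ht : t ∈ T) (hst : s < t) :
    sweptArea (fun t => x t) (fun t => y t) s t = a * c * (t - s) := by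
  obtain ⟨-, -, -, -, -, hac, h⟩ := h
  unfold sweptArea
  beta_reduce
  rw [(h s hs).1, (h s hs).2, (h t ht).1, (h t ht).2]
  -- As soon as `t` lies beyond `σ`, the horizontal rate `b * d` has to be exchanged for `a * c`.
  split_ifs with h1 h2 h3 h4 h5 <;> first | (exfalso; linarith) | skip
  all_goals
    simp only [mul_one, mul_zero]
    first
    | linear_combination (-(t - s)) * hac
    | linear_combination (σ - t) * hac
    | ring

theorem FamilyIII.sweptArea_eq {a b c d : ℝ} (h : FamilyIII T x y a b c d) {s t : ℝ} (hs : s ∈ T)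
    (ht : t ∈ T) : sweptArea (fun t => x t) (fun t => y t) s t =
      (a * d + b * c) * (t - s) - b * d * (t - s) ^ 2 := by
  obtain ⟨-, -, h⟩ := h
  unfold sweptArea
  beta_reduce
  rw [(h s hs).1, (h s hs).2, (h t ht).1, (h t ht).2]
  ring

theorem FamilyIV.areas {a b c : ℝ} (h : FamilyIV T x y a b c) {s t : ℝ} (hs : s ∈ T)
    (ht : t ∈ T) : ((x t : ℝ) - x s) * y t = a * b * (1 - Real.exp (-(c * (t - s)))) ∧
      (x s : ℝ) * (y s - y t) = a * b * (1 - Real.exp (-(c * (t - s)))) := by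
  obtain ⟨-, -, -, h⟩ := h
  rw [(h s hs).1, (h s hs).2, (h t ht).1, (h t ht).2]
  have e1 : Real.exp (c * s) * Real.exp (-(c * t)) = Real.exp (-(c * (t - s))) := by
    rw [← Real.exp_add]; ring_nf
  have e2 : ∀ t, Real.exp (c * t) * Real.exp (-(c * t)) = 1 := fun t => by
    rw [← Real.exp_add]; simp
  constructor
  · linear_combination a * b * e2 t - a * b * e1
  · linear_combination a * b * e2 s - a * b * e1

theorem FamilyIV.sweptArea_eq {a b c : ℝ} (h : FamilyIV T x y a b c) {s t : ℝ} (hs : s ∈ T)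
    (ht : t ∈ T) : sweptArea (fun t => x t) (fun t => y t) s t =
      2 * a * b * (1 - Real.exp (-(c * (t - s)))) := by
  unfold sweptArea
  rw [(h.areas hs ht).1, (h.areas hs ht).2]
  ring

theorem exists_sub_mem_add_mem {T : Set ℝ} {p : ℝ} (hp : p ∈ interior T) :
    ∃ u > 0, p - u ∈ T ∧ p + u ∈ T ∧ p ∈ T := by
  obtain ⟨ε, hε, hb⟩ := Metric.isOpen_iff.1 isOpen_interior p hp
  refine ⟨ε / 2, by positivity, interior_subset (hb ?_), interior_subset (hb ?_),
    interior_subset hp⟩ <;>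
  · rw [Metric.mem_ball, Real.dist_eq, abs_lt]
    constructor <;> linarith

theorem FamilyII.area_not_stationary {σ a b c d : ℝ} (h : FamilyII T x y σ a b c d)
    (hstat : ∀ s ∈ T, ∀ t ∈ T, ∀ s' ∈ T, ∀ t' ∈ T, s < t → t' - s' = t - s →
      ((x t' : ℝ) - x s') * y t' = (x t - x s) * y t) : False := by
  obtain ⟨hσ, -, hb, -, hd, -, h⟩ := h
  obtain ⟨u, hu, h1, h2, h3⟩ := exists_sub_mem_add_mem hσ
  -- The right-hand rectangle has area zero before the turn and `d * u * b` after it.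
  have := hstat _ h1 _ h3 _ h3 _ h2 (by linarith) (by ring)
  rw [(h _ h1).1, (h _ h2).1, (h _ h2).2, (h _ h3).1, (h _ h3).2] at this
  rw [if_neg (by linarith : ¬ σ < σ - u), if_pos (by linarith : σ < σ + u)] at this
  have h0 : d * u * b = 0 := by simpa [hu.not_ge] using this
  exact (by positivity : d * u * b ≠ 0) h0

theorem FamilyIII.area_not_stationary {a b c d : ℝ} (h : FamilyIII T x y a b c d)
    (hT : (interior T).Nonempty)
    (hstat : ∀ s ∈ T, ∀ t ∈ T, ∀ s' ∈ T, ∀ t' ∈ T, s < t → t' - s' = t - s →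
      ((x t' : ℝ) - x s') * y t' = (x t - x s) * y t) : False := by
  obtain ⟨hb, hd, h⟩ := h
  obtain ⟨p, hp⟩ := hT
  obtain ⟨u, hu, h1, h2, h3⟩ := exists_sub_mem_add_mem hp
  -- Two adjacent windows of length `u` have right-hand rectangles of equal width whose heights
  -- differ by `d * u`.
  have := hstat _ h1 _ h3 _ h3 _ h2 (by linarith) (by ring)
  rw [(h _ h1).1, (h _ h2).1, (h _ h2).2, (h _ h3).1, (h _ h3).2] at this
  have h0 : b * d * u ^ 2 = 0 := by linear_combination -this
  exact (by positivity : b * d * u ^ 2 ≠ 0) h0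

end Paths

/-! ### From laws of increments to areas. -/

section Increments

variable {Ω : Type*} [MeasurableSpace Ω] {d : ℕ} {P : Measure Ω} [IsProbabilityMeasure P]
  {X : Quarter → Ω → EuclideanSpace ℝ (Fin d)} {ψ : EuclideanSpace ℝ (Fin d) → ℂ}
  {T : Set ℝ} {x y : ℝ → ℝ≥0}

theorem charFun_along_sub (hX : IsTPLP P X) (hψ : IsExponent P X ψ) (hα : IsDecreasingPath T x y)
    {s t : ℝ} (hs : s ∈ T) (ht : t ∈ T) (hst : s < t) (z : EuclideanSpace ℝ (Fin d)) :
    charFun (P.map fun ω => along X x y t ω - along X x y s ω) z =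
      Complex.exp ((((x t : ℝ) - x s) * y t : ℝ) * ψ z +
        ((x s : ℝ) * (y s - y t) : ℝ) * ψ (-z)) :=
  charFun_along hX hψ (p := (x s, y s)) (q := (x t, y t)) (hα.monotone_x hs ht hst.le)
    (hα.antitone_y hs ht hst.le) z

/-- Both exponents are continuous and vanish at `0`, so equality of their exponentials is equality
of the exponents. -/
theorem hasStationaryIncrements_iff (hX : IsTPLP P X) (hψ : IsExponent P X ψ)
    (hα : IsDecreasingPath T x y) :
    HasStationaryIncrements P T (along X x y) ↔
      ∀ s ∈ T, ∀ t ∈ T, ∀ s' ∈ T, ∀ t' ∈ T, s < t → t' - s' = t - s → ∀ z,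
        (((x t : ℝ) - x s) * y t : ℝ) * ψ z + ((x s : ℝ) * (y s - y t) : ℝ) * ψ (-z) =
        (((x t' : ℝ) - x s') * y t' : ℝ) * ψ z + ((x s' : ℝ) * (y s' - y t') : ℝ) * ψ (-z) := by
  have hm : ∀ s t, Measurable fun ω => along X x y t ω - along X x y s ω := fun s t =>
    (hX.measurable _).sub (hX.measurable _)
  have hcont : ∀ a b : ℝ, Continuous fun z => (a : ℂ) * ψ z + (b : ℂ) * ψ (-z) := fun a b =>
    (continuous_const.mul hψ.continuous).add
      (continuous_const.mul (hψ.continuous.comp continuous_neg))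
  refine ⟨fun h s hs t ht s' hs' t' ht' hst hd => ?_, fun h s hs t ht s' hs' t' ht' hst hd => ?_⟩
  · refine congrFun (eq_of_exp_eq (hcont _ _) (hcont _ _) 0 (by simp [hψ.map_zero]) fun z => ?_)
    rw [← charFun_along_sub hX hψ hα hs ht hst,
      ← charFun_along_sub hX hψ hα hs' ht' (by linarith),
      (h s hs t ht s' hs' t' ht' hst hd).map_eq]
  · refine ⟨(hm s t).aemeasurable, (hm s' t').aemeasurable, ?_⟩
    have h1 := Measure.isProbabilityMeasure_map (μ := P) (hm s t).aemeasurable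
    have h2 := Measure.isProbabilityMeasure_map (μ := P) (hm s' t').aemeasurable
    refine Measure.ext_of_charFun (funext fun z => ?_)
    rw [charFun_along_sub hX hψ hα hs ht hst,
      charFun_along_sub hX hψ hα hs' ht' (by linarith), h s hs t ht s' hs' t' ht' hst hd z]

theorem sweptArea_stationary (hX : IsTPLP P X) (hψ : IsExponent P X ψ)
    (hnd : ¬ IsDeterministicSheet P X) (hα : IsDecreasingPath T x y)
    (hst : HasStationaryIncrements P T (along X x y)) :
    ∀ s ∈ T, ∀ t ∈ T, ∀ s' ∈ T, ∀ t' ∈ T, s < t → t' - s' = t - s →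
      sweptArea (fun t => x t) (fun t => y t) s' t' =
        sweptArea (fun t => x t) (fun t => y t) s t := by
  intro s hs t ht s' hs' t' ht' hlt hd
  obtain ⟨z, hz⟩ := exists_re_exponent_ne_zero hX hψ hnd
  have := congrArg Complex.re
    ((hasStationaryIncrements_iff hX hψ hα).1 hst s hs t ht s' hs' t' ht' hlt hd z)
  simp only [exponent_neg hψ z, Complex.add_re, Complex.re_ofReal_mul, Complex.conj_re] at this
  refine mul_right_cancel₀ hz ?_
  simp only [sweptArea]
  linarith

/-- Where `ψ z` is not real, imaginary parts give the difference of the two rectangle areas; the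
real part already gave their sum. -/
theorem area_stationary_of_not_isSymmetric (hX : IsTPLP P X) (hψ : IsExponent P X ψ)
    (hnd : ¬ IsDeterministicSheet P X) (hα : IsDecreasingPath T x y) (hs : ¬ IsSymmetric P X)
    (hst : HasStationaryIncrements P T (along X x y)) :
    ∀ s ∈ T, ∀ t ∈ T, ∀ s' ∈ T, ∀ t' ∈ T, s < t → t' - s' = t - s →
      ((x t' : ℝ) - x s') * y t' = (x t - x s) * y t := by
  obtain ⟨z, hz⟩ : ∃ z, ψ (-z) ≠ ψ z := by
    by_contra! h
    exact hs (isSymmetric_of_exponent_even hX hψ h)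
  have hz' : (ψ z).im ≠ 0 := fun h => hz (by
    rw [exponent_neg hψ]; exact Complex.conj_eq_iff_im.2 h)
  intro s hs t ht s' hs' t' ht' hlt hd
  have h1 := congrArg Complex.im
    ((hasStationaryIncrements_iff hX hψ hα).1 hst s hs t ht s' hs' t' ht' hlt hd z)
  simp only [exponent_neg hψ z, Complex.add_im, Complex.im_ofReal_mul, Complex.conj_im] at h1
  have h2 := sweptArea_stationary hX hψ hnd hα hst s hs t ht s' hs' t' ht' hlt hd
  simp only [sweptArea] at h2
  have h3 : ((x t : ℝ) - x s) * y t - x s * (y s - y t) =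
      ((x t' : ℝ) - x s') * y t' - x s' * (y s' - y t') := by
    refine mul_right_cancel₀ hz' ?_
    linarith
  linarith

theorem hasIncrementCharFun_of_sweptArea (hX : IsTPLP P X) (hψ : IsExponent P X ψ)
    (hα : IsDecreasingPath T x y) (heven : ∀ z, ψ (-z) = ψ z) (φ : ℝ → ℝ)
    (hφ : ∀ s ∈ T, ∀ t ∈ T, s < t →
      sweptArea (fun t => x t) (fun t => y t) s t = φ (t - s)) :
    HasIncrementCharFun P T (along X x y) φ ψ := by
  intro s hs t ht hst z
  rw [charFun_along_sub hX hψ hα hs ht hst, heven, ← add_mul, ← Complex.ofReal_add,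
    ← hφ s hs t ht hst]
  rfl

end Increments

end LevySheet

theorem theorem2 {Ω : Type*} [MeasurableSpace Ω] (P : Measure Ω) [IsProbabilityMeasure P]
    (d : ℕ) (X : Quarter → Ω → EuclideanSpace ℝ (Fin d)) (ψ : EuclideanSpace ℝ (Fin d) → ℂ)
    (hX : IsTPLP P X) (hψ : IsExponent P X ψ) (hnd : ¬ IsDeterministicSheet P X)
    (T : Set ℝ) (x y : ℝ → ℝ≥0) (hα : IsDecreasingPath T x y) :
    (IsSymmetric P X →
      (HasStationaryIncrements P T (along X x y) ↔
        (∃ a b c : ℝ, FamilyI T x y a b c) ∨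
        (∃ σ a b c d : ℝ, FamilyII T x y σ a b c d) ∨
        (∃ a b c d : ℝ, FamilyIII T x y a b c d) ∨
        (∃ a b c : ℝ, FamilyIV T x y a b c)) ∧
      (∀ a b c : ℝ, FamilyI T x y a b c →
        HasIncrementCharFun P T (along X x y) (fun u => a * c * u) ψ) ∧
      (∀ σ a b c d : ℝ, FamilyII T x y σ a b c d →
        HasIncrementCharFun P T (along X x y) (fun u => a * c * u) ψ) ∧
      (∀ a b c d : ℝ, FamilyIII T x y a b c d →
        HasIncrementCharFun P T (along X x y)
          (fun u => (a * d + b * c) * u - b * d * u ^ 2) ψ) ∧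
      (∀ a b c : ℝ, FamilyIV T x y a b c →
        HasIncrementCharFun P T (along X x y)
          (fun u => 2 * a * b * (1 - Real.exp (-(c * u)))) ψ)) ∧
    (¬ IsSymmetric P X →
      (HasStationaryIncrements P T (along X x y) ↔
        (∃ a b c : ℝ, FamilyI T x y a b c) ∨
        (∃ a b c : ℝ, FamilyIV T x y a b c)) ∧
      (∀ a b c : ℝ, FamilyIV T x y a b c →
        HasIncrementCharFun P T (along X x y)
          (fun u => 2 * a * b * (1 - Real.exp (-(c * u))))
          (fun z => (ψ z + ψ (-z)) / 2))) := by
  have hchar := hasStationaryIncrements_iff hX hψ hα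
  have hI : ∀ a b c, FamilyI T x y a b c → HasStationaryIncrements P T (along X x y) := by
    intro a b c h
    rw [hchar]
    intro s hs t ht s' hs' t' ht' _ hd z
    rcases h.areas with h | h <;>
      rw [(h s hs t ht).1, (h s hs t ht).2, (h s' hs' t' ht').1, (h s' hs' t' ht').2, hd]
  have hIV : ∀ a b c, FamilyIV T x y a b c → HasStationaryIncrements P T (along X x y) := by
    intro a b c h
    rw [hchar]
    intro s hs t ht s' hs' t' ht' _ hd z
    rw [(h.areas hs ht).1, (h.areas hs ht).2, (h.areas hs' ht').1, (h.areas hs' ht').2, hd]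
  have hsum := fun hst => hα.exists_family (sweptArea_stationary hX hψ hnd hα hst)
  refine ⟨fun hs => ?_, fun hs => ?_⟩
  · have heven := exponent_even_of_isSymmetric hX hψ hs
    have hexp := hasIncrementCharFun_of_sweptArea hX hψ hα heven
    have hstat : ∀ φ : ℝ → ℝ, (∀ s ∈ T, ∀ t ∈ T, s < t →
        sweptArea (fun t => x t) (fun t => y t) s t = φ (t - s)) →
        HasStationaryIncrements P T (along X x y) := by
      intro φ hφ
      rw [hchar]
      intro s hs t ht s' hs' t' ht' hst hd z
      have h1 := (hφ s hs t ht hst).trans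
        ((congrArg φ hd.symm).trans (hφ s' hs' t' ht' (by linarith)).symm)
      simp only [sweptArea] at h1
      rw [heven, ← add_mul, ← add_mul, ← Complex.ofReal_add, ← Complex.ofReal_add, h1]
    have hII : ∀ σ a b c d, FamilyII T x y σ a b c d → ∀ s ∈ T, ∀ t ∈ T, s < t →
        sweptArea (fun t => x t) (fun t => y t) s t = a * c * (t - s) :=
      fun σ a b c d h s hs t ht hst => h.sweptArea_eq hs ht hst
    have hIII : ∀ a b c d, FamilyIII T x y a b c d → ∀ s ∈ T, ∀ t ∈ T, s < t →
        sweptArea (fun t => x t) (fun t => y t) s t =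
          (a * d + b * c) * (t - s) - b * d * (t - s) ^ 2 :=
      fun a b c d h s hs t ht _ => h.sweptArea_eq hs ht
    refine ⟨⟨hsum, ?_⟩, ?_, ?_, ?_, ?_⟩
    · rintro (⟨a, b, c, h⟩ | ⟨σ, a, b, c, d, h⟩ | ⟨a, b, c, d, h⟩ | ⟨a, b, c, h⟩)
      · exact hI a b c h
      · exact hstat (fun u => a * c * u) (hII σ a b c d h)
      · exact hstat (fun u => (a * d + b * c) * u - b * d * u ^ 2) (hIII a b c d h)
      · exact hIV a b c h
    · exact fun a b c h => hexp _ fun s hs t ht _ => h.sweptArea_eq hs ht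
    · exact fun σ a b c d h => hexp _ (hII σ a b c d h)
    · exact fun a b c d h => hexp _ (hIII a b c d h)
    · exact fun a b c h => hexp _ fun s hs t ht _ => h.sweptArea_eq hs ht
  · refine ⟨⟨fun hst => ?_, ?_⟩, ?_⟩
    · have harea := area_stationary_of_not_isSymmetric hX hψ hnd hα hs hst
      rcases hsum hst with h | ⟨σ, a, b, c, d, h⟩ | ⟨a, b, c, d, h⟩ | h
      · exact Or.inl h
      · exact (h.area_not_stationary harea).elim
      · exact (h.area_not_stationary hα.nonempty_interior harea).elim
      · exact Or.inr h
    · rintro (⟨a, b, c, h⟩ | ⟨a, b, c, h⟩)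
      · exact hI a b c h
      · exact hIV a b c h
    · intro a b c h s hs t ht hst z
      rw [charFun_along_sub hX hψ hα hs ht hst, (h.areas hs ht).1, (h.areas hs ht).2]
      congr 1
      push_cast
      ring
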